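/- Let $p>1$, $\kappa,\beta>0$, $\alpha\in\mathbb{R}$ and $c\in\mathbb{R}$ with $c^2>1$ satisfy $$c^4(1-4\kappa)+\alpha^2+2c^2(2\kappa-\alpha)<0 .$$ For real-valued $u\in H^2(\mathbb{R})$ put $$I_c(u)=\frac12\int_{\mathbb{R}}\left(\kappa c^2u_{xx}^2+(c^2-\alpha)u_x^2+(c^2-1)u^2\right)dx ,$$ and consider the variational problem $$\inf\{I_c(u):\ u\in H^2(\mathbb{R}),\ \|u\|_{L^{p+2}(\mathbb{R})}=1\}. \qquad (*)$$ If $\{u_n\}$ is a minimizing sequence of $(*)$ (that is, $u_n\in H^2(\mathbb{R})$, $\|u_n\|_{L^{p+2}(\mathbb{R})}=1$ for all $n$, and $I_c(u_n)$ converges to the infimum), then there are a subsequence $\{u_{n_k}\}$, scalars $y_k\in\mathbb{R}$ and $u\in H^2(\mathbb{R})$ such that $u_{n_k}(\cdot+y_k)\to u$ in $H^2(\mathbb{R})$ and $u$ is a minimizer of $(*)$. Moreover, this minimizer yields a solitary wave: for some $\mu>0$, the function $\mu u$ agrees almost everywhere with a function $Q\in C^4(\mathbb{R})$, $Q\not\equiv0$,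 such that $Q(x)\to0$ as $|x|\to\infty$ and $$\kappa c^2Q''''+(\alpha-c^2)Q''+(c^2-1)Q=\beta|Q|^pQ\quad\text{on }\mathbb{R},$$ which is the equation of the profiles $Q(x-ct)$ of solitary waves of speed $c$ of $u_{tt}=(u-\alpha u_{xx}+u_{tt}-\kappa u_{xxtt}+\beta|u|^pu)_{xx}$. -/

import Mathlib

open MeasureTheory Filter Topology
open scoped ContDiff

namespace Boussinesq

/-- `v` is the weak (distributional) derivative of `u` on the real line: both functions are
locally integrable and `∫ u φ' = - ∫ v φ` for every test function `φ ∈ C_c^∞(ℝ)`. -/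
def HasWeakDeriv (u v : ℝ → ℝ) : Prop :=
  LocallyIntegrable u ∧ LocallyIntegrable v ∧
    ∀ φ : ℝ → ℝ, ContDiff ℝ ∞ φ → HasCompactSupport φ →
      ∫ x, u x * deriv φ x = - ∫ x, v x * φ x

open Classical in
/-- The weak derivative of `u`, well defined up to a null set whenever it exists
(and `0` by convention if `u` has no weak derivative). -/
noncomputable def weakDeriv (u : ℝ → ℝ) : ℝ → ℝ :=
  if h : ∃ v, HasWeakDeriv u v then h.choose else 0

/-- Membership in the real Sobolev space `H²(ℝ)`: `u` is square integrable and has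
square integrable first and second weak derivatives. -/
def MemH2 (u : ℝ → ℝ) : Prop :=
  MemLp u 2 ∧ ∃ v w : ℝ → ℝ,
    MemLp v 2 ∧ MemLp w 2 ∧ HasWeakDeriv u v ∧ HasWeakDeriv v w

/-- The norm of `H²(ℝ)`, `(∫ u² + (u')² + (u'')²)^{1/2}`. -/
noncomputable def h2Norm (u : ℝ → ℝ) : ℝ :=
  √(∫ x, (u x ^ 2 + weakDeriv u x ^ 2 + weakDeriv (weakDeriv u) x ^ 2))

/-- The functional `I_c(u) = ½ ∫ κ c² (u'')² + (c² - α) (u')² + (c² - 1) u²`. -/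
noncomputable def functionalI (κ α c : ℝ) (u : ℝ → ℝ) : ℝ :=
  1 / 2 * ∫ x, (κ * c ^ 2 * weakDeriv (weakDeriv u) x ^ 2
    + (c ^ 2 - α) * weakDeriv u x ^ 2 + (c ^ 2 - 1) * u x ^ 2)

/-- The constraint set `{u ∈ H²(ℝ) : ‖u‖_{L^{p+2}} = 1}`. -/
def admissible (p : ℝ) : Set (ℝ → ℝ) :=
  {u | MemH2 u ∧ eLpNorm u (ENNReal.ofReal (p + 2)) volume = 1}

/-- `u` is a minimizer of `I_c` on the constraint set. -/
def IsMinimizer (p κ α c : ℝ) (u : ℝ → ℝ) : Prop :=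
  u ∈ admissible p ∧ ∀ v ∈ admissible p, functionalI κ α c u ≤ functionalI κ α c v

/-- `(u n)` is a minimizing sequence: every `u n` is admissible and `I_c (u n)` converges to
the infimum of `I_c` over the constraint set. -/
def IsMinimizingSeq (p κ α c : ℝ) (u : ℕ → ℝ → ℝ) : Prop :=
  (∀ n, u n ∈ admissible p) ∧
    ∃ m : ℝ, IsGLB (functionalI κ α c '' admissible p) m ∧
      Tendsto (fun n => functionalI κ α c (u n)) atTop (𝓝 m)

/-- `Q` is the profile of a solitary wave of speed `c`: a nontrivial classical solution,
vanishing at infinity, of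
`κ c² Q'''' + (α - c²) Q'' + (c² - 1) Q = β |Q|^p Q`. -/
def IsSolitaryWave (p κ α β c : ℝ) (Q : ℝ → ℝ) : Prop :=
  ContDiff ℝ 4 Q ∧ Q ≠ 0 ∧ Tendsto Q (cocompact ℝ) (𝓝 0) ∧
    ∀ x, κ * c ^ 2 * iteratedDeriv 4 Q x + (α - c ^ 2) * iteratedDeriv 2 Q x
      + (c ^ 2 - 1) * Q x = β * (|Q x| ^ p * Q x)

end Boussinesq

/-! Put `a = κc²`, `b = c² - α`, `d = c² - 1`. The discriminant hypothesis says `b² < 4ad`, so the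
energy `E(u) = ∫ a u''² + b u'² + d u²`, which is `2 I_c`, controls the squared `H²` norm even when
`b < 0` (`exists_coercive`).

Compactness comes from strict subadditivity (`exists_convergent_subseq`). A bounded minimizing
sequence cannot be uniformly small in sup norm, since `∫ |u|^{p+2} ≤ (sup |u|)^p ∫ u²`. After
translation it stays away from zero at the origin, so its weak limit `u` is nonzero. With `m = inf
E` and `l = ∫ |u|^{p+2}`, weak convergence gives `E(u_n - u) → m - E(u)`, and a Brezis-Lieb
splitting gives `∫ |u_n - u|^{p+2} → 1 - l`. By homogeneity `E(f) ≥ m (∫ |f|^{p+2})^r` with `r =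
2/(p+2) < 1`. Applied to `u` and to `u_n - u`, this yields `l^r + (1-l)^r ≤ 1`, which forces `l =
1`. Then `E(u) = m`, and coercivity turns `E(u_n - u) → 0` into strong convergence.

The homogeneous inequality also gives the Euler-Lagrange equation by unconstrained differentiation
(`IsH2.euler_lagrange`). Integrating the weak equation once gives classical regularity
(`IsH2.exists_classical`), and scaling replaces the multiplier by `β`. Throughout, `IsH2` carries
continuous representatives, so that pointwise values make sense. -/

namespace Boussinesq

/-! ### Weak derivatives and primitives on the line -/

theorem integrable_mul_of_hasCompactSupport {f φ : ℝ → ℝ} (hf : LocallyIntegrable f)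
    (hφ : Continuous φ) (hc : HasCompactSupport φ) : Integrable (fun x => f x * φ x) := by
  simpa [smul_eq_mul, mul_comm] using hf.integrable_smul_left_of_hasCompactSupport hφ hc

theorem exists_Icc_of_hasCompactSupport {φ : ℝ → ℝ} (hc : HasCompactSupport φ) :
    ∃ R : ℝ, 0 < R ∧ ∀ x, R ≤ |x| → φ x = 0 := by
  obtain ⟨R, hR, h⟩ := hc.exists_pos_le_norm
  exact ⟨R, hR, fun x hx => h x (by simpa using hx)⟩

/-- A test function of mean zero is the derivative of a test function. -/
theorem exists_testFunction_deriv_eq {ψ : ℝ → ℝ} (hψ : ContDiff ℝ ∞ ψ) (hc : HasCompactSupport ψ)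
    (h0 : ∫ x, ψ x = 0) :
    ∃ φ : ℝ → ℝ, ContDiff ℝ ∞ φ ∧ HasCompactSupport φ ∧ deriv φ = ψ := by
  obtain ⟨R, hR, hz⟩ := exists_Icc_of_hasCompactSupport hc
  have hψi : Integrable ψ := hψ.continuous.integrable_of_hasCompactSupport hc
  set φ : ℝ → ℝ := fun x => ∫ t in (-R)..x, ψ t with hφ
  have hd : ∀ x, HasDerivAt φ (ψ x) x := fun x =>
    intervalIntegral.integral_hasDerivAt_right (hψ.continuous.intervalIntegrable _ _)
      (hψ.continuous.stronglyMeasurableAtFilter _ _) hψ.continuous.continuousAt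
  have hderiv : deriv φ = ψ := funext fun x => (hd x).deriv
  refine ⟨φ, ?_, ?_, hderiv⟩
  · rw [contDiff_infty_iff_deriv]
    exact ⟨fun x => (hd x).differentiableAt, hderiv ▸ hψ⟩
  · refine HasCompactSupport.intro (isCompact_Icc (a := -R) (b := R)) fun x hx => ?_
    rcases lt_or_ge x (-R) with h | h
    · simp only [hφ]
      rw [intervalIntegral.integral_symm, neg_eq_zero]
      refine intervalIntegral.integral_zero_ae (Eventually.of_forall fun t ht => hz t ?_)
      rw [Set.uIoc_of_le h.le] at ht
      rw [abs_of_nonpos (by linarith [ht.2])]; linarith [ht.2]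
    · have h2 : R < x := by
        by_contra! h3
        exact hx ⟨h, h3⟩
      simp only [hφ]
      -- To the right of the support the primitive equals the full integral, which is zero by the
      -- mean-zero hypothesis.
      rw [intervalIntegral.integral_of_le h, ← h0]
      refine setIntegral_eq_integral_of_forall_compl_eq_zero fun t ht => hz t ?_
      by_contra! h3
      rw [abs_lt] at h3
      exact ht ⟨h3.1, by linarith [h3.2]⟩

theorem exists_testFunction_integral_one :
    ∃ ρ : ℝ → ℝ, ContDiff ℝ ∞ ρ ∧ HasCompactSupport ρ ∧ ∫ x, ρ x = 1 := by
  let b : ContDiffBump (0 : ℝ) := ⟨1, 2, one_pos, one_lt_two⟩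
  exact ⟨b.normed volume, b.contDiff_normed, b.hasCompactSupport_normed, b.integral_normed⟩

/-- If `f'' = g'` in the sense of distributions, then `f' = g + C` for a constant `C`. -/
theorem exists_hasWeakDeriv_add_const {f g : ℝ → ℝ} (hf : LocallyIntegrable f)
    (hg : LocallyIntegrable g)
    (h : ∀ φ : ℝ → ℝ, ContDiff ℝ ∞ φ → HasCompactSupport φ →
      ∫ x, f x * deriv (deriv φ) x = - ∫ x, g x * deriv φ x) :
    ∃ C : ℝ, HasWeakDeriv f (fun x => g x + C) := by
  obtain ⟨ρ, hρ, hρc, hρ1⟩ := exists_testFunction_integral_one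
  have hdC : ∀ {φ : ℝ → ℝ}, ContDiff ℝ ∞ φ → Continuous (deriv φ) := fun hφ =>
    hφ.continuous_deriv (by simp)
  -- The value forced by testing the conclusion against `ρ`. A general `φ` differs from a multiple
  -- of `ρ` by a mean-zero function, hence by the derivative of a test function, to which `h`
  -- applies.
  set C : ℝ := -(∫ x, f x * deriv ρ x) - ∫ x, g x * ρ x with hC
  refine ⟨C, hf, hg.add (locallyIntegrable_const C), fun φ hφ hφc => ?_⟩
  set m : ℝ := ∫ x, φ x with hm
  have hφi : Integrable φ := hφ.continuous.integrable_of_hasCompactSupport hφc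
  have hρi : Integrable ρ := hρ.continuous.integrable_of_hasCompactSupport hρc
  have hmρc : HasCompactSupport (fun x => m * ρ x) := hρc.mul_left
  obtain ⟨θ, hθ, hθc, hθd⟩ := exists_testFunction_deriv_eq (ψ := fun x => φ x - m * ρ x)
    (hφ.sub (contDiff_const.mul hρ))
    (by simpa using! hφc.sub hmρc)
    (by rw [integral_sub hφi (hρi.const_mul m), integral_const_mul, hρ1]; simp [hm])
  have key := h θ hθ hθc
  rw [hθd] at key
  have hdd : deriv (fun x => φ x - m * ρ x) = fun x => deriv φ x - m * deriv ρ x := by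
    funext x
    have h1 := (hφ.differentiable (by simp) x).hasDerivAt
    have h2 := (hρ.differentiable (by simp) x).hasDerivAt
    exact (h1.sub (h2.const_mul m)).deriv
  rw [hdd] at key
  have i1 := integrable_mul_of_hasCompactSupport hf (hdC hφ) hφc.deriv
  have i2 := integrable_mul_of_hasCompactSupport hf (hdC hρ) hρc.deriv
  have i3 := integrable_mul_of_hasCompactSupport hg hφ.continuous hφc
  have i4 := integrable_mul_of_hasCompactSupport hg hρ.continuous hρc
  have e1 : ∫ x, f x * (deriv φ x - m * deriv ρ x)
      = (∫ x, f x * deriv φ x) - m * ∫ x, f x * deriv ρ x := by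
    rw [← integral_const_mul, ← integral_sub i1 (i2.const_mul m)]
    congr 1; ext x; ring
  have e2 : ∫ x, g x * (φ x - m * ρ x)
      = (∫ x, g x * φ x) - m * ∫ x, g x * ρ x := by
    rw [← integral_const_mul, ← integral_sub i3 (i4.const_mul m)]
    congr 1; ext x; ring
  have e3 : ∫ x, (g x + C) * φ x = (∫ x, g x * φ x) + C * m := by
    rw [hm, ← integral_const_mul, ← integral_add i3 (hφi.const_mul C)]
    congr 1; ext x; ring
  rw [e1, e2] at key
  rw [e3, hC]
  linarith

theorem HasWeakDeriv.congr {u u' v v' : ℝ → ℝ} (h : HasWeakDeriv u v) (hu : u =ᵐ[volume] u')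
    (hv : v =ᵐ[volume] v') : HasWeakDeriv u' v' := by
  refine ⟨(locallyIntegrable_congr hu).1 h.1, (locallyIntegrable_congr hv).1 h.2.1,
    fun φ hφ hc => ?_⟩
  have := h.2.2 φ hφ hc
  rw [integral_congr_ae (g := fun x => u x * deriv φ x), this,
    integral_congr_ae (g := fun x => v' x * φ x)]
  · filter_upwards [hv] with x hx using by rw [hx]
  · filter_upwards [hu] with x hx using by rw [hx]

theorem HasWeakDeriv.ae_eq {u v v' : ℝ → ℝ} (h : HasWeakDeriv u v) (h' : HasWeakDeriv u v') :
    v =ᵐ[volume] v' := by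
  refine ae_eq_of_integral_contDiff_smul_eq h.2.1 h'.2.1 fun φ hφ hc => ?_
  have h1 := h.2.2 φ hφ hc
  have h2 := h'.2.2 φ hφ hc
  simp only [smul_eq_mul, mul_comm (φ _)]
  linarith

/-- The zero function has second distributional derivative `u' = 0`, so some `u + C` is a weak
derivative of `0`; uniqueness makes it vanish. -/
theorem HasWeakDeriv.ae_const {u : ℝ → ℝ} (h : HasWeakDeriv u 0) :
    ∃ C : ℝ, ∀ᵐ x, u x = C := by
  obtain ⟨C, hC⟩ := exists_hasWeakDeriv_add_const (f := 0) (g := u)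
    (by simpa using! locallyIntegrable_const (0 : ℝ)) h.1 (fun φ hφ hc => by
      rw [h.2.2 φ hφ hc]; simp)
  have h0 : HasWeakDeriv 0 0 := ⟨hC.1, hC.1, fun φ _ _ => by simp⟩
  refine ⟨-C, ?_⟩
  filter_upwards [hC.ae_eq h0] with x hx
  simp only [Pi.zero_apply] at hx
  linarith

theorem HasWeakDeriv.add {u v u' v' : ℝ → ℝ} (h : HasWeakDeriv u v) (h' : HasWeakDeriv u' v') :
    HasWeakDeriv (fun x => u x + u' x) (fun x => v x + v' x) := by
  refine ⟨h.1.add h'.1, h.2.1.add h'.2.1, fun φ hφ hc => ?_⟩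
  have hd : Continuous (deriv φ) := hφ.continuous_deriv (by simp)
  simp only [add_mul]
  rw [integral_add (integrable_mul_of_hasCompactSupport h.1 hd hc.deriv)
    (integrable_mul_of_hasCompactSupport h'.1 hd hc.deriv),
    integral_add (integrable_mul_of_hasCompactSupport h.2.1 hφ.continuous hc)
    (integrable_mul_of_hasCompactSupport h'.2.1 hφ.continuous hc), h.2.2 φ hφ hc, h'.2.2 φ hφ hc]
  ring

theorem HasWeakDeriv.const_mul {u v : ℝ → ℝ} (h : HasWeakDeriv u v) (a : ℝ) :
    HasWeakDeriv (fun x => a * u x) (fun x => a * v x) := by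
  refine ⟨h.1.smul a, h.2.1.smul a, fun φ hφ hc => ?_⟩
  simp only [mul_assoc, integral_const_mul, h.2.2 φ hφ hc]
  ring

theorem locallyIntegrable_comp_add_right {u : ℝ → ℝ} (h : LocallyIntegrable u) (y : ℝ) :
    LocallyIntegrable (fun x => u (x + y)) := by
  have h1 := (locallyIntegrable_map_homeomorph (Homeomorph.addRight y) (f := u) (μ := volume)).1
    (by
      have : Measure.map (Homeomorph.addRight y) (volume : Measure ℝ) = volume :=
        map_add_right_eq_self volume y
      rwa [this])
  exact h1

/-- `F` is a primitive of the locally integrable function `f`. -/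
def IsPrimitive (F f : ℝ → ℝ) : Prop :=
  LocallyIntegrable f ∧ ∀ a b, ∫ x in a..b, f x = F b - F a

theorem intervalIntegrable_of_locallyIntegrable {f : ℝ → ℝ} (hf : LocallyIntegrable f) (a b : ℝ) :
    IntervalIntegrable f volume a b :=
  intervalIntegrable_iff.mpr
    ((hf.integrableOn_isCompact isCompact_uIcc).mono_set Set.uIoc_subset_uIcc)

theorem exists_isPrimitive {f : ℝ → ℝ} (hf : LocallyIntegrable f) : ∃ F, IsPrimitive F f :=
  ⟨fun x => ∫ t in (0 : ℝ)..x, f t, hf, fun a b => by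
    rw [intervalIntegral.integral_interval_sub_left] <;>
      exact intervalIntegrable_of_locallyIntegrable hf _ _⟩

theorem isPrimitive_of_hasDerivAt {F f : ℝ → ℝ} (hF : ∀ x, HasDerivAt F (f x) x)
    (hf : Continuous f) : IsPrimitive F f :=
  ⟨hf.locallyIntegrable, fun _ _ => intervalIntegral.integral_eq_sub_of_hasDerivAt
    (fun x _ => hF x) (hf.intervalIntegrable _ _)⟩

theorem IsPrimitive.absolutelyContinuousOnInterval {F f : ℝ → ℝ} (h : IsPrimitive F f) (a b : ℝ) :
    AbsolutelyContinuousOnInterval F a b := by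
  have h1 := (intervalIntegrable_of_locallyIntegrable
    h.1 a b).absolutelyContinuousOnInterval_intervalIntegral (c := a) (by simp)
  have h2 : AbsolutelyContinuousOnInterval (fun _ : ℝ => F a) a b :=
    (LipschitzWith.const (F a)).lipschitzOnWith.absolutelyContinuousOnInterval
  have h3 := h1.fun_add h2
  have : (fun x => (∫ t in a..x, f t) + F a) = F := by
    funext x; rw [h.2]; ring
  rwa [this] at h3

theorem IsPrimitive.ae_hasDerivAt {F f : ℝ → ℝ} (h : IsPrimitive F f) :
    ∀ᵐ x, HasDerivAt F (f x) x := by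
  filter_upwards [_root_.LocallyIntegrable.ae_hasDerivAt_integral h.1] with x hx
  have : F = fun x => (∫ t in (0 : ℝ)..x, f t) + F 0 := by
    funext x; rw [h.2]; ring
  rw [this]
  exact (hx 0).add_const _

theorem IsPrimitive.continuous {F f : ℝ → ℝ} (h : IsPrimitive F f) : Continuous F := by
  have : F = fun x => (∫ t in (0 : ℝ)..x, f t) + F 0 := by
    funext x; rw [h.2]; ring
  rw [this]
  exact (intervalIntegral.continuous_primitive
    (fun a b => intervalIntegrable_of_locallyIntegrable h.1 a b) 0).add continuous_const

theorem IsPrimitive.hasDerivAt {F f : ℝ → ℝ} (h : IsPrimitive F f) (hf : Continuous f) (x : ℝ) :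
    HasDerivAt F (f x) x := by
  have : F = fun x => (∫ t in (0 : ℝ)..x, f t) + F 0 := by
    funext x; rw [h.2]; ring
  rw [this]
  exact (hf.integral_hasStrictDerivAt 0 x).hasDerivAt.add_const _

theorem IsPrimitive.congr_right {F f g : ℝ → ℝ} (h : IsPrimitive F f) (hfg : f =ᵐ[volume] g) :
    IsPrimitive F g :=
  ⟨(locallyIntegrable_congr hfg).1 h.1, fun a b => by
    rw [← h.2 a b]
    exact intervalIntegral.integral_congr_ae (hfg.mono fun x hx _ => hx.symm)⟩

/-- The product rule for absolutely continuous functions, which underlies the integrations by parts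
below. -/
theorem IsPrimitive.mul {F f G g : ℝ → ℝ} (h : IsPrimitive F f) (h' : IsPrimitive G g) :
    IsPrimitive (fun x => F x * G x) (fun x => f x * G x + F x * g x) := by
  refine ⟨(h.1.mul_continuous h'.continuous).add (h'.1.continuous_mul h.continuous), fun a b => ?_⟩
  rw [← (h.absolutelyContinuousOnInterval a b).integral_deriv_mul_eq_sub
    (h'.absolutelyContinuousOnInterval a b)]
  refine intervalIntegral.integral_congr_ae ?_
  filter_upwards [h.ae_hasDerivAt, h'.ae_hasDerivAt] with x hx hx' _
  rw [hx.deriv, hx'.deriv]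

theorem IsPrimitive.hasWeakDeriv {F f : ℝ → ℝ} (h : IsPrimitive F f) : HasWeakDeriv F f := by
  refine ⟨h.continuous.locallyIntegrable, h.1, fun φ hφ hc => ?_⟩
  have hd : Continuous (deriv φ) := hφ.continuous_deriv (by simp)
  have hP : IsPrimitive φ (deriv φ) :=
    isPrimitive_of_hasDerivAt (fun x => (hφ.differentiable (by simp) x).hasDerivAt) hd
  obtain ⟨R, hR, hz⟩ := exists_Icc_of_hasCompactSupport hc
  have i1 := integrable_mul_of_hasCompactSupport h.continuous.locallyIntegrable hd hc.deriv
  have i2 := integrable_mul_of_hasCompactSupport h.1 hφ.continuous hc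
  have hi := i2.add i1
  have h1 := intervalIntegral_tendsto_integral hi tendsto_neg_atTop_atBot tendsto_id
  have h2 : ∀ᶠ T : ℝ in atTop,
      ∫ x in (-T)..(id T), ((fun x => f x * φ x) + fun x => F x * deriv φ x) x = 0 := by
    filter_upwards [eventually_ge_atTop R] with T hT
    have := (h.mul hP).2 (-T) T
    simp only [Pi.add_apply, id]
    rw [this]
    beta_reduce
    rw [hz T (by rwa [abs_of_nonneg (by linarith)]),
      hz (-T) (by rwa [abs_neg, abs_of_nonneg (by linarith)])]
    simp
  have h3 := tendsto_nhds_unique h1 (tendsto_const_nhds.congr' (h2.mono fun _ h => h.symm))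
  rw [integral_add' i2 i1] at h3
  linarith

/-- Subtracting any primitive of `v` from `u` leaves a zero weak derivative, hence a constant. -/
theorem HasWeakDeriv.exists_isPrimitive {u v : ℝ → ℝ} (h : HasWeakDeriv u v) :
    ∃ U, U =ᵐ[volume] u ∧ IsPrimitive U v := by
  obtain ⟨F, hF⟩ := Boussinesq.exists_isPrimitive h.2.1
  have h1 := h.add (hF.hasWeakDeriv.const_mul (-1))
  obtain ⟨C, hC⟩ := (h1.congr (v' := 0) EventuallyEq.rfl
    (Eventually.of_forall fun x => by simp)).ae_const
  refine ⟨fun x => F x + C, ?_, hF.1, fun a b => by rw [hF.2]; ring⟩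
  filter_upwards [hC] with x hx
  linarith

theorem IsPrimitive.add {F f G g : ℝ → ℝ} (h : IsPrimitive F f) (h' : IsPrimitive G g) :
    IsPrimitive (fun x => F x + G x) (fun x => f x + g x) :=
  ⟨h.1.add h'.1, fun a b => by
    rw [intervalIntegral.integral_add (intervalIntegrable_of_locallyIntegrable h.1 a b)
      (intervalIntegrable_of_locallyIntegrable h'.1 a b), h.2, h'.2]; ring⟩

theorem IsPrimitive.const_mul {F f : ℝ → ℝ} (h : IsPrimitive F f) (a : ℝ) :
    IsPrimitive (fun x => a * F x) (fun x => a * f x) :=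
  ⟨h.1.smul a, fun _ _ => by rw [intervalIntegral.integral_const_mul, h.2]; ring⟩

theorem IsPrimitive.comp_add_right {F f : ℝ → ℝ} (h : IsPrimitive F f) (y : ℝ) :
    IsPrimitive (fun x => F (x + y)) (fun x => f (x + y)) :=
  ⟨locallyIntegrable_comp_add_right h.1 y, fun a b => by
    rw [intervalIntegral.integral_comp_add_right, h.2]⟩

theorem integrable_mul_of_memLp {f g : ℝ → ℝ} (hf : MemLp f 2) (hg : MemLp g 2) :
    Integrable (fun x => f x * g x) :=
  hf.integrable_mul hg

theorem integral_lincomb {f g h : ℝ → ℝ} (hf : Integrable f) (hg : Integrable g)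
    (hh : Integrable h) (a b d : ℝ) : ∫ x, (a * f x + b * g x + d * h x)
      = a * (∫ x, f x) + b * (∫ x, g x) + d * ∫ x, h x := by
  rw [integral_add (f := fun x => a * f x + b * g x) ((hf.const_mul a).add (hg.const_mul b))
    (hh.const_mul d), integral_add (hf.const_mul a) (hg.const_mul b)]
  simp only [integral_const_mul]

/-- `U` and `V` are the absolutely continuous representatives of a function in `H²(ℝ)` and of its
derivative, and `W` is the second derivative. -/
structure IsH2 (U V W : ℝ → ℝ) : Prop where
  memLp : MemLp U 2
  memLp_deriv : MemLp V 2
  memLp_deriv2 : MemLp W 2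
  isPrimitive : IsPrimitive U V
  isPrimitive_deriv : IsPrimitive V W

namespace IsH2

variable {U V W U' V' W' : ℝ → ℝ}

theorem add (h : IsH2 U V W) (h' : IsH2 U' V' W') :
    IsH2 (fun x => U x + U' x) (fun x => V x + V' x) (fun x => W x + W' x) :=
  ⟨h.1.add h'.1, h.2.add h'.2, h.3.add h'.3, h.4.add h'.4, h.5.add h'.5⟩

theorem const_mul (h : IsH2 U V W) (a : ℝ) :
    IsH2 (fun x => a * U x) (fun x => a * V x) (fun x => a * W x) :=
  ⟨h.1.const_mul a, h.2.const_mul a, h.3.const_mul a, h.4.const_mul a, h.5.const_mul a⟩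

theorem sub (h : IsH2 U V W) (h' : IsH2 U' V' W') :
    IsH2 (fun x => U x - U' x) (fun x => V x - V' x) (fun x => W x - W' x) := by
  have := h.add (h'.const_mul (-1))
  simpa [sub_eq_add_neg] using this

theorem comp_add_right (h : IsH2 U V W) (y : ℝ) :
    IsH2 (fun x => U (x + y)) (fun x => V (x + y)) (fun x => W (x + y)) := by
  have hp := measurePreserving_add_right (volume : Measure ℝ) y
  exact ⟨h.1.comp_measurePreserving hp, h.2.comp_measurePreserving hp,
    h.3.comp_measurePreserving hp, h.4.comp_add_right y, h.5.comp_add_right y⟩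

theorem continuous (h : IsH2 U V W) : Continuous U := h.4.continuous

theorem integrable_energy (h : IsH2 U V W) (a b d : ℝ) :
    Integrable (fun x => a * W x ^ 2 + b * V x ^ 2 + d * U x ^ 2) :=
  ((h.3.integrable_sq.const_mul a).add (h.2.integrable_sq.const_mul b)).add
    (h.1.integrable_sq.const_mul d)

end IsH2

theorem isH2_of_testFunction {φ : ℝ → ℝ} (hφ : ContDiff ℝ ∞ φ) (hc : HasCompactSupport φ) :
    IsH2 φ (deriv φ) (deriv (deriv φ)) := by
  have h1 : ContDiff ℝ ∞ (deriv φ) := (contDiff_infty_iff_deriv.1 hφ).2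
  have h2 : ContDiff ℝ ∞ (deriv (deriv φ)) := (contDiff_infty_iff_deriv.1 h1).2
  exact ⟨hφ.continuous.memLp_of_hasCompactSupport hc,
    h1.continuous.memLp_of_hasCompactSupport hc.deriv,
    h2.continuous.memLp_of_hasCompactSupport hc.deriv.deriv,
    isPrimitive_of_hasDerivAt (fun x => (hφ.differentiable (by simp) x).hasDerivAt) h1.continuous,
    isPrimitive_of_hasDerivAt (fun x => (h1.differentiable (by simp) x).hasDerivAt) h2.continuous⟩

theorem MemH2.exists_isH2 {u : ℝ → ℝ} (h : MemH2 u) : ∃ U V W, u =ᵐ[volume] U ∧ IsH2 U V W := by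
  obtain ⟨hu, v, w, hv, hw, huv, hvw⟩ := h
  obtain ⟨U, hU, hUv⟩ := huv.exists_isPrimitive
  obtain ⟨V, hV, hVw⟩ := hvw.exists_isPrimitive
  exact ⟨U, V, w, hU.symm, hu.ae_eq hU.symm, hv.ae_eq hV.symm, hw, hUv.congr_right hV.symm, hVw⟩

theorem IsH2.memH2 {U V W u : ℝ → ℝ} (h : IsH2 U V W) (hu : u =ᵐ[volume] U) : MemH2 u :=
  ⟨h.1.ae_eq hu.symm, V, W, h.2, h.3, h.4.hasWeakDeriv.congr hu.symm EventuallyEq.rfl,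
    h.5.hasWeakDeriv⟩

theorem HasWeakDeriv.weakDeriv_ae_eq {u v : ℝ → ℝ} (h : HasWeakDeriv u v) :
    weakDeriv u =ᵐ[volume] v := by
  have hex : ∃ v, HasWeakDeriv u v := ⟨v, h⟩
  rw [weakDeriv, dif_pos hex]
  exact hex.choose_spec.ae_eq h

theorem IsH2.weakDeriv_ae_eq {U V W u : ℝ → ℝ} (h : IsH2 U V W) (hu : u =ᵐ[volume] U) :
    weakDeriv u =ᵐ[volume] V :=
  (h.4.hasWeakDeriv.congr hu.symm EventuallyEq.rfl).weakDeriv_ae_eq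

theorem IsH2.weakDeriv_weakDeriv_ae_eq {U V W u : ℝ → ℝ} (h : IsH2 U V W)
    (hu : u =ᵐ[volume] U) : weakDeriv (weakDeriv u) =ᵐ[volume] W :=
  (h.5.hasWeakDeriv.congr (h.weakDeriv_ae_eq hu).symm EventuallyEq.rfl).weakDeriv_ae_eq

theorem IsH2.functionalI_eq {U V W u : ℝ → ℝ} (h : IsH2 U V W) (hu : u =ᵐ[volume] U)
    (κ α c : ℝ) : functionalI κ α c u
      = 1 / 2 * ∫ x, (κ * c ^ 2 * W x ^ 2 + (c ^ 2 - α) * V x ^ 2 + (c ^ 2 - 1) * U x ^ 2) := by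
  rw [functionalI]
  congr 1
  refine integral_congr_ae ?_
  filter_upwards [hu, h.weakDeriv_ae_eq hu, h.weakDeriv_weakDeriv_ae_eq hu] with x h1 h2 h3
  rw [h1, h2, h3]

theorem IsH2.h2Norm_eq {U V W u : ℝ → ℝ} (h : IsH2 U V W) (hu : u =ᵐ[volume] U) :
    h2Norm u = √(∫ x, (U x ^ 2 + V x ^ 2 + W x ^ 2)) := by
  rw [h2Norm]
  congr 1
  refine integral_congr_ae ?_
  filter_upwards [hu, h.weakDeriv_ae_eq hu, h.weakDeriv_weakDeriv_ae_eq hu] with x h1 h2 h3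
  rw [h1, h2, h3]

/-! ### The Sobolev embedding -/

section Sobolev

variable {U V W : ℝ → ℝ}

/-- The weight `y - x - 1` is `-1` at `x` and `0` at `x + 1`, so integrating `((y - x - 1) U)'`
leaves only `U x`. This makes evaluation at a point an `L²` pairing. -/
theorem IsPrimitive.apply_eq_integral (h : IsPrimitive U V) (x : ℝ) :
    U x = ∫ y in x..(x + 1), (U y + (y - x - 1) * V y) := by
  have hG : IsPrimitive (fun y : ℝ => y - x - 1) (fun _ => 1) :=
    isPrimitive_of_hasDerivAt
      (fun y => by simpa using! ((hasDerivAt_id y).sub_const x).sub_const 1) continuous_const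
  have h1 := (hG.mul h).2 x (x + 1)
  simp only [one_mul] at h1
  rw [h1]
  ring

theorem IsPrimitive.sq_le_intervalIntegral (h : IsPrimitive U V) (hU : MemLp U 2) (hV : MemLp V 2)
    (x : ℝ) : U x ^ 2 ≤ ∫ y in x..(x + 1), 2 * (U y ^ 2 + V y ^ 2) := by
  have hi : IntervalIntegrable (fun y => U y + (y - x - 1) * V y) volume x (x + 1) :=
    intervalIntegrable_of_locallyIntegrable (h.continuous.locallyIntegrable.add
      (h.1.continuous_mul (by fun_prop))) _ _
  -- Linearizing the square replaces Cauchy-Schwarz by the pointwise bound `2st - s² ≤ t²`; the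
  -- interval has length one.
  have h2 : U x ^ 2
      = ∫ y in x..(x + 1), (2 * U x * (U y + (y - x - 1) * V y) - U x ^ 2) := by
    rw [intervalIntegral.integral_sub (hi.const_mul _) intervalIntegrable_const,
      intervalIntegral.integral_const_mul, ← h.apply_eq_integral x]
    simp
    ring
  rw [h2]
  refine intervalIntegral.integral_mono_on (by linarith)
    ((hi.const_mul _).sub intervalIntegrable_const)
    (((hU.integrable_sq.add hV.integrable_sq).const_mul 2).intervalIntegrable) fun y hy => ?_
  have h3 : (y - x - 1) ^ 2 ≤ 1 := by nlinarith [hy.1, hy.2]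
  have h4 : ((y - x - 1) * V y) ^ 2 ≤ V y ^ 2 := by
    rw [mul_pow]; nlinarith [sq_nonneg (V y)]
  nlinarith [sq_nonneg (U x - (U y + (y - x - 1) * V y)), sq_nonneg (U y - (y - x - 1) * V y)]

theorem IsPrimitive.sq_le_integral (h : IsPrimitive U V) (hU : MemLp U 2) (hV : MemLp V 2)
    (x : ℝ) : U x ^ 2 ≤ 2 * ∫ y, (U y ^ 2 + V y ^ 2) := by
  refine (h.sq_le_intervalIntegral hU hV x).trans ?_
  rw [intervalIntegral.integral_of_le (by linarith), ← integral_const_mul]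
  exact setIntegral_le_integral ((hU.integrable_sq.add hV.integrable_sq).const_mul 2)
    (Eventually.of_forall fun y => by positivity)

theorem IsPrimitive.tendsto_cocompact (h : IsPrimitive U V) (hU : MemLp U 2) (hV : MemLp V 2) :
    Tendsto U (cocompact ℝ) (𝓝 0) := by
  have hi : Integrable (fun y => 2 * (U y ^ 2 + V y ^ 2)) :=
    (hU.integrable_sq.add hV.integrable_sq).const_mul 2
  have hii : ∀ a b, IntervalIntegrable (fun y => 2 * (U y ^ 2 + V y ^ 2)) volume a b :=
    fun a b => hi.intervalIntegrable
  -- An integrable function has vanishing mass on unit windows escaping to infinity.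
  have key : Tendsto (fun x => ∫ y in x..(x + 1), 2 * (U y ^ 2 + V y ^ 2)) (cocompact ℝ) (𝓝 0) := by
    rw [cocompact_eq_atBot_atTop, tendsto_sup]
    constructor
    · have h1 := intervalIntegral_tendsto_integral_Iic 0 hi.integrableOn tendsto_id
      have h2 := intervalIntegral_tendsto_integral_Iic 0 hi.integrableOn
        (tendsto_atBot_add_const_right atBot (1 : ℝ) tendsto_id)
      have h3 := h1.sub h2
      rw [sub_self] at h3
      refine h3.congr fun x => ?_
      simp only [id]
      rw [intervalIntegral.integral_interval_sub_interval_comm (hii _ _) (hii _ _) (hii _ _)]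
      simp
    · have h1 := intervalIntegral_tendsto_integral_Ioi 0 hi.integrableOn tendsto_id
      have h2 := intervalIntegral_tendsto_integral_Ioi 0 hi.integrableOn
        (tendsto_atTop_add_const_right atTop (1 : ℝ) tendsto_id)
      have h3 := h2.sub h1
      rw [sub_self] at h3
      refine h3.congr fun x => ?_
      simp only [id]
      exact intervalIntegral.integral_interval_sub_left (hii _ _) (hii _ _)
  have h2 : Tendsto (fun x => U x ^ 2) (cocompact ℝ) (𝓝 0) :=
    squeeze_zero (fun x => sq_nonneg _) (fun x => h.sq_le_intervalIntegral hU hV x) key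
  have h3 := h2.sqrt
  simp only [Real.sqrt_sq_eq_abs, Real.sqrt_zero] at h3
  exact (tendsto_zero_iff_abs_tendsto_zero _).2 h3

/-- Integration of `(UV)'` over the line; the boundary terms vanish because `U` and `V` tend to zero
at infinity. -/
theorem IsH2.integral_deriv_sq (h : IsH2 U V W) :
    ∫ x, V x ^ 2 = - ∫ x, U x * W x := by
  have hi : Integrable (fun x => V x * V x + U x * W x) :=
    (integrable_mul_of_memLp h.2 h.2).add (integrable_mul_of_memLp h.1 h.3)
  have h1 := intervalIntegral_tendsto_integral hi tendsto_neg_atTop_atBot tendsto_id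
  have hU := h.4.tendsto_cocompact h.1 h.2
  have hV := h.5.tendsto_cocompact h.2 h.3
  rw [cocompact_eq_atBot_atTop, tendsto_sup] at hU hV
  have h2 := (hU.2.mul hV.2).sub
    ((hU.1.comp tendsto_neg_atTop_atBot).mul (hV.1.comp tendsto_neg_atTop_atBot))
  have h3 := tendsto_nhds_unique h1 (h2.congr fun T => ((h.4.mul h.5).2 (-T) T).symm)
  rw [integral_add (integrable_mul_of_memLp h.2 h.2) (integrable_mul_of_memLp h.1 h.3)] at h3
  simp only [sq]
  linarith

/-- Coercivity of the energy on `H²(ℝ)`, under the discriminant condition. -/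
theorem exists_coercive {a b d : ℝ} (ha : 0 < a) (hd : 0 < d) (hb : b ^ 2 < 4 * a * d) :
    ∃ δ : ℝ, 0 < δ ∧ ∀ U V W : ℝ → ℝ, IsH2 U V W →
      δ * ∫ x, (U x ^ 2 + V x ^ 2 + W x ^ 2)
        ≤ ∫ x, (a * W x ^ 2 + b * V x ^ 2 + d * U x ^ 2) := by
  -- Chosen so that `(a - ε)(d - ε) = b²/4 + ε²`: the form `aW² - bUW + dU²` remains nonnegative
  -- after subtracting `ε(U² + W²)`.
  set ε : ℝ := (4 * a * d - b ^ 2) / (4 * (a + d)) with hε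
  have had : 0 < a + d := by linarith
  have hε0 : 0 < ε := by rw [hε]; apply div_pos <;> linarith
  have hεm : 4 * (a + d) * ε = 4 * a * d - b ^ 2 := by rw [hε]; field_simp
  have hεa : ε < a := by nlinarith [sq_nonneg b, mul_pos ha ha]
  -- Adding `∫ V² ≤ ½ ∫ (U² + W²)` costs a factor `3/2`, which `ε / 2` absorbs.
  refine ⟨ε / 2, by linarith, fun U V W h => ?_⟩
  have iU := h.1.integrable_sq
  have iV := h.2.integrable_sq
  have iW := h.3.integrable_sq
  have iUW := integrable_mul_of_memLp h.1 h.3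
  have hV := h.integral_deriv_sq
  have hV2 : ∫ x, V x ^ 2 ≤ 1 / 2 * ∫ x, (U x ^ 2 + W x ^ 2) := by
    rw [hV, ← integral_neg, ← integral_const_mul]
    refine integral_mono iUW.neg ((iU.add iW).const_mul _) fun x => ?_
    simp only
    nlinarith [sq_nonneg (U x + W x)]
  have hE : ∫ x, (a * W x ^ 2 + b * V x ^ 2 + d * U x ^ 2)
      = ∫ x, (a * W x ^ 2 - b * (U x * W x) + d * U x ^ 2) := by
    rw [integral_lincomb iW iV iU, hV]
    have := integral_lincomb iW iUW iU a (-b) d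
    simp only [neg_mul, ← sub_eq_add_neg] at this
    rw [this]
    ring
  have hlow : ε * ∫ x, (U x ^ 2 + W x ^ 2)
      ≤ ∫ x, (a * W x ^ 2 - b * (U x * W x) + d * U x ^ 2) := by
    rw [← integral_const_mul]
    refine integral_mono ((iU.add iW).const_mul _)
      (((iW.const_mul a).sub (iUW.const_mul b)).add (iU.const_mul d)) fun x => ?_
    simp only
    have hq : 0 ≤ (a - ε) * ((a - ε) * W x ^ 2 - b * (U x * W x) + (d - ε) * U x ^ 2) := by
      have h1 : (a - ε) * (d - ε) = b ^ 2 / 4 + ε ^ 2 := by nlinarith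
      have : (a - ε) * ((a - ε) * W x ^ 2 - b * (U x * W x) + (d - ε) * U x ^ 2)
        = ((a - ε) * W x - b / 2 * U x) ^ 2 + ((a - ε) * (d - ε) - b ^ 2 / 4) * U x ^ 2 := by ring
      rw [this, h1]
      have : 0 ≤ ε ^ 2 * U x ^ 2 := by positivity
      nlinarith [sq_nonneg ((a - ε) * W x - b / 2 * U x)]
    have := nonneg_of_mul_nonneg_right hq (by linarith)
    linarith
  have hsplit : ∫ x, (U x ^ 2 + V x ^ 2 + W x ^ 2)
      = (∫ x, (U x ^ 2 + W x ^ 2)) + ∫ x, V x ^ 2 := by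
    rw [← integral_add (f := fun x => U x ^ 2 + W x ^ 2) (iU.add iW) iV]
    congr 1; ext x; ring
  have hpos : 0 ≤ ∫ x, (U x ^ 2 + W x ^ 2) := integral_nonneg fun x => by positivity
  rw [hE, hsplit]
  refine le_trans ?_ hlow
  nlinarith

end Sobolev

/-! ### Weak compactness -/

/-- Bounded sequences in `L²(ℝ)` have weakly convergent subsequences. -/
theorem exists_weakly_convergent_subseq {f : ℕ → ℝ → ℝ} (hf : ∀ n, MemLp (f n) 2) {M : ℝ}
    (hM : ∀ n, ∫ x, f n x ^ 2 ≤ M) :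
    ∃ (k : ℕ → ℕ) (g : ℝ → ℝ), StrictMono k ∧ MemLp g 2 ∧ ∀ h : ℝ → ℝ, MemLp h 2 →
      Tendsto (fun n => ∫ x, f (k n) x * h x) atTop (𝓝 (∫ x, g x * h x)) := by
  have : Fact ((2 : ENNReal) ≠ ⊤) := ⟨by simp⟩
  let H := Lp ℝ 2 (volume : Measure ℝ)
  let F : ℕ → H := fun n => (hf n).toLp (f n)
  have inner_eq : ∀ (n : ℕ) (h : ℝ → ℝ) (hh : MemLp h 2),
      inner ℝ (F n) (hh.toLp h) = ∫ x, f n x * h x := by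
    intro n h hh
    rw [L2.inner_def]
    refine integral_congr_ae ?_
    filter_upwards [(hf n).coeFn_toLp, hh.coeFn_toLp] with x hx hx'
    simp only [F, hx, hx']
    simp [mul_comm]
  have hnorm : ∀ n, ‖F n‖ ≤ √M := by
    intro n
    have h1 : ‖F n‖ ^ 2 = ∫ x, f n x ^ 2 := by
      rw [← real_inner_self_eq_norm_sq, inner_eq]
      simp only [sq]
    exact Real.le_sqrt_of_sq_le (h1.trans_le (hM n))
  -- Sequential Banach-Alaoglu, transported to `L²` by the Riesz isomorphism.
  have hsc := WeakDual.isSeqCompact_closedBall ℝ H 0 (√M)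
  obtain ⟨ψ, -, k, hk, hlim⟩ := hsc
    (x := fun n => StrongDual.toWeakDual (InnerProductSpace.toDual ℝ H (F n))) (fun n => by
      simpa using hnorm n)
  let G : H := (InnerProductSpace.toDual ℝ H).symm (WeakDual.toStrongDual ψ)
  refine ⟨k, G, hk, Lp.memLp G, fun h hh => ?_⟩
  have h1 := ((WeakDual.eval_continuous (𝕜 := ℝ) (hh.toLp h)).tendsto ψ).comp hlim
  have h2 : ψ (hh.toLp h) = ∫ x, G x * h x := by
    have : ψ (hh.toLp h) = inner ℝ G (hh.toLp h) := by
      simp only [G, InnerProductSpace.toDual_symm_apply]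
      rfl
    rw [this, L2.inner_def]
    refine integral_congr_ae ?_
    filter_upwards [hh.coeFn_toLp] with x hx'
    simp only [hx']
    simp [mul_comm]
  rw [h2] at h1
  refine h1.congr fun n => ?_
  rw [← inner_eq]
  rfl

/-- `f n` converges weakly to `g` in `L²(ℝ)`. -/
def WeakL2Tendsto (f : ℕ → ℝ → ℝ) (g : ℝ → ℝ) : Prop :=
  ∀ h : ℝ → ℝ, MemLp h 2 → Tendsto (fun n => ∫ x, f n x * h x) atTop (𝓝 (∫ x, g x * h x))

theorem WeakL2Tendsto.congr {f : ℕ → ℝ → ℝ} {g g' : ℝ → ℝ} (h : WeakL2Tendsto f g)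
    (hg : g =ᵐ[volume] g') : WeakL2Tendsto f g' := fun φ hφ => by
  rw [← integral_congr_ae (f := fun x => g x * φ x)]
  · exact h φ hφ
  · filter_upwards [hg] with x hx using by rw [hx]

theorem WeakL2Tendsto.comp {f : ℕ → ℝ → ℝ} {g : ℝ → ℝ} (h : WeakL2Tendsto f g) {k : ℕ → ℕ}
    (hk : StrictMono k) : WeakL2Tendsto (fun n => f (k n)) g := fun φ hφ =>
  (h φ hφ).comp hk.tendsto_atTop

theorem WeakL2Tendsto.hasWeakDeriv {f f' : ℕ → ℝ → ℝ} {g g' : ℝ → ℝ} (h : WeakL2Tendsto f g)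
    (h' : WeakL2Tendsto f' g') (hg : MemLp g 2) (hg' : MemLp g' 2)
    (hd : ∀ n, HasWeakDeriv (f n) (f' n)) : HasWeakDeriv g g' := by
  refine ⟨hg.locallyIntegrable (by norm_num), hg'.locallyIntegrable (by norm_num),
    fun φ hφ hc => ?_⟩
  have hφd : Continuous (deriv φ) := hφ.continuous_deriv (by simp)
  have h1 := h (deriv φ) (hφd.memLp_of_hasCompactSupport hc.deriv)
  have h2 := (h' φ (hφ.continuous.memLp_of_hasCompactSupport hc)).neg
  exact tendsto_nhds_unique (h1.congr fun n => (hd n).2.2 φ hφ hc) h2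

/-- By `IsPrimitive.apply_eq_integral`, the value at `x` is a sum of pairings of the function and
its derivative with two fixed `L²` functions. -/
theorem WeakL2Tendsto.tendsto_apply {f f' : ℕ → ℝ → ℝ} {g g' : ℝ → ℝ} (h : WeakL2Tendsto f g)
    (h' : WeakL2Tendsto f' g') (hf : ∀ n, MemLp (f n) 2) (hf' : ∀ n, MemLp (f' n) 2)
    (hg : MemLp g 2) (hg' : MemLp g' 2)
    (hP : ∀ n, IsPrimitive (f n) (f' n)) (hPg : IsPrimitive g g') (x : ℝ) :
    Tendsto (fun n => f n x) atTop (𝓝 (g x)) := by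
  let s : Set ℝ := Set.Ioc x (x + 1)
  have hs : volume s ≠ ⊤ := by simp [s]
  have m1 : MemLp (s.indicator fun _ => (1 : ℝ)) 2 :=
    memLp_indicator_const 2 measurableSet_Ioc 1 (Or.inr hs)
  have m2 : MemLp (s.indicator fun y => y - x - 1) 2 := by
    rw [memLp_indicator_iff_restrict measurableSet_Ioc]
    have : IsFiniteMeasure (volume.restrict s) := ⟨by simpa using hs.lt_top⟩
    refine MemLp.of_bound (by fun_prop) 1 ?_
    filter_upwards [ae_restrict_mem measurableSet_Ioc] with y hy
    rw [Real.norm_eq_abs, abs_le]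
    constructor <;> linarith [hy.1, hy.2]
  have key : ∀ F G : ℝ → ℝ, MemLp F 2 → MemLp G 2 → IsPrimitive F G →
      F x = (∫ y, F y * s.indicator (fun _ => (1 : ℝ)) y)
        + ∫ y, G y * s.indicator (fun y => y - x - 1) y := by
    intro F G hF hG hFG
    rw [← integral_add (integrable_mul_of_memLp hF m1) (integrable_mul_of_memLp hG m2),
      hFG.apply_eq_integral x, intervalIntegral.integral_of_le (by linarith),
      ← integral_indicator measurableSet_Ioc]
    congr 1
    ext y
    by_cases hy : y ∈ Set.Ioc x (x + 1)
    · simp only [s, Set.indicator_of_mem hy]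
      ring
    · simp only [s, Set.indicator_of_notMem hy]
      ring
  rw [key g g' hg hg' hPg]
  exact ((h _ m1).add (h' _ m2)).congr fun n => (key _ _ (hf n) (hf' n) (hP n)).symm

/-- Bounded sequences in `H²(ℝ)` have subsequences which converge weakly and pointwise. -/
theorem exists_weakly_convergent_subseq_H2 {U V W : ℕ → ℝ → ℝ} (h : ∀ n, IsH2 (U n) (V n) (W n))
    {M : ℝ} (hM : ∀ n, ∫ x, (U n x ^ 2 + V n x ^ 2 + W n x ^ 2) ≤ M) :
    ∃ (k : ℕ → ℕ) (u v w : ℝ → ℝ), StrictMono k ∧ IsH2 u v w ∧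
      WeakL2Tendsto (fun n => U (k n)) u ∧ WeakL2Tendsto (fun n => V (k n)) v ∧
      WeakL2Tendsto (fun n => W (k n)) w ∧ ∀ x, Tendsto (fun n => U (k n) x) atTop (𝓝 (u x)) := by
  have hi : ∀ n, Integrable (fun x => U n x ^ 2 + V n x ^ 2 + W n x ^ 2) := fun n =>
    ((h n).1.integrable_sq.add (h n).2.integrable_sq).add (h n).3.integrable_sq
  have bU : ∀ n, ∫ x, U n x ^ 2 ≤ M := fun n => le_trans
    (integral_mono (h n).1.integrable_sq (hi n) fun x => by
      simp only; nlinarith [sq_nonneg (V n x), sq_nonneg (W n x)]) (hM n)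
  have bV : ∀ n, ∫ x, V n x ^ 2 ≤ M := fun n => le_trans
    (integral_mono (h n).2.integrable_sq (hi n) fun x => by
      simp only; nlinarith [sq_nonneg (U n x), sq_nonneg (W n x)]) (hM n)
  have bW : ∀ n, ∫ x, W n x ^ 2 ≤ M := fun n => le_trans
    (integral_mono (h n).3.integrable_sq (hi n) fun x => by
      simp only; nlinarith [sq_nonneg (V n x), sq_nonneg (U n x)]) (hM n)
  obtain ⟨k₁, u, hk₁, hu, hu'⟩ := exists_weakly_convergent_subseq (fun n => (h n).1) bU
  obtain ⟨k₂, v, hk₂, hv, hv'⟩ := exists_weakly_convergent_subseq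
    (f := fun n => V (k₁ n)) (fun n => (h _).2) (fun n => bV _)
  obtain ⟨k₃, w, hk₃, hw, hw'⟩ := exists_weakly_convergent_subseq
    (f := fun n => W (k₁ (k₂ n))) (fun n => (h _).3) (fun n => bW _)
  let k : ℕ → ℕ := fun n => k₁ (k₂ (k₃ n))
  have wu : WeakL2Tendsto (fun n => U (k n)) u :=
    WeakL2Tendsto.comp (f := fun n => U (k₁ n)) hu' (hk₂.comp hk₃)
  have wv : WeakL2Tendsto (fun n => V (k n)) v :=
    WeakL2Tendsto.comp (f := fun n => V (k₁ (k₂ n))) hv' hk₃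
  have ww : WeakL2Tendsto (fun n => W (k n)) w := hw'
  have d1 := wu.hasWeakDeriv wv hu hv fun n => (h (k n)).4.hasWeakDeriv
  have d2 := wv.hasWeakDeriv ww hv hw fun n => (h (k n)).5.hasWeakDeriv
  obtain ⟨u', hu1, hu2⟩ := d1.exists_isPrimitive
  obtain ⟨v', hv1, hv2⟩ := d2.exists_isPrimitive
  have hH : IsH2 u' v' w :=
    ⟨hu.ae_eq hu1.symm, hv.ae_eq hv1.symm, hw, hu2.congr_right hv1.symm, hv2⟩
  have wu' := wu.congr hu1.symm
  have wv' := wv.congr hv1.symm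
  exact ⟨k, u', v', w, hk₁.comp (hk₂.comp hk₃), hH, wu', wv', ww,
    wu'.tendsto_apply wv' (fun n => (h _).1) (fun n => (h _).2) hH.1 hH.2 (fun n => (h _).4) hH.4⟩

/-! ### The nonlinearity -/

section Power

variable {p : ℝ}

theorem hasDerivAt_abs_rpow_mul_self (hp : 1 < p) (t : ℝ) :
    HasDerivAt (fun s : ℝ => |s| ^ p * s) ((p + 1) * |t| ^ p) t := by
  have h := (hasDerivAt_abs_rpow t hp).mul (hasDerivAt_id t)
  refine h.congr_deriv ?_
  simp only [id, mul_one]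
  have : |t| ^ (p - 2) * t * t = |t| ^ p := by
    rcases eq_or_ne t 0 with rfl | ht
    · simp [Real.zero_rpow (by linarith : p ≠ 0)]
    · have h1 : 0 < |t| := abs_pos.2 ht
      rw [mul_assoc, ← sq, ← sq_abs, ← Real.rpow_natCast, ← Real.rpow_add h1]
      norm_num
  linear_combination p * this

theorem hasDerivAt_abs_rpow_add_two (hp : 1 < p) (t : ℝ) :
    HasDerivAt (fun s : ℝ => |s| ^ (p + 2)) ((p + 2) * (|t| ^ p * t)) t := by
  refine (hasDerivAt_abs_rpow t (by linarith : 1 < p + 2)).congr_deriv ?_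
  rw [add_sub_cancel_right]
  ring

theorem abs_rpow_mul_self_sub_le (hp : 1 < p) {M s t : ℝ} (hs : |s| ≤ M) (ht : |t| ≤ M) :
    |(|t| ^ p * t - |s| ^ p * s)| ≤ (p + 1) * M ^ p * |t - s| := by
  have := (convex_Icc (-M) M).norm_image_sub_le_of_norm_hasDerivWithin_le
    (f := fun s : ℝ => |s| ^ p * s) (f' := fun t => (p + 1) * |t| ^ p) (C := (p + 1) * M ^ p)
    (fun x _ => (hasDerivAt_abs_rpow_mul_self hp x).hasDerivWithinAt) (fun x hx => by
      rw [Real.norm_of_nonneg (by positivity)]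
      have := Real.rpow_le_rpow (abs_nonneg x) (abs_le.2 hx) (by linarith : 0 ≤ p)
      gcongr) (abs_le.1 hs) (abs_le.1 ht)
  simpa using this

/-- Mean value inequality for `s ↦ |a + s|^{p+2} - |s|^{p+2}`, whose derivative is `O(|a|)`. An
error bilinear in `|a|`, `|b|` is what the Brezis-Lieb splitting needs. -/
theorem abs_add_rpow_sub_sub_le (hp : 1 < p) {M a b : ℝ} (ha : |a| ≤ M) (hb : |b| ≤ M) :
    |(|a + b| ^ (p + 2) - |a| ^ (p + 2) - |b| ^ (p + 2))|
      ≤ (p + 2) * ((p + 1) * (2 * M) ^ p) * (|a| * |b|) := by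
  have hM : 0 ≤ M := (abs_nonneg a).trans ha
  have hd : ∀ x, HasDerivAt (fun s : ℝ => |a + s| ^ (p + 2) - |s| ^ (p + 2))
      ((p + 2) * (|a + x| ^ p * (a + x)) - (p + 2) * (|x| ^ p * x)) x := fun x =>
    ((hasDerivAt_abs_rpow_add_two hp (a + x)).comp_const_add a x).sub
      (hasDerivAt_abs_rpow_add_two hp x)
  have := (convex_Icc (-M) M).norm_image_sub_le_of_norm_hasDerivWithin_le
    (C := (p + 2) * ((p + 1) * (2 * M) ^ p) * |a|)
    (fun x _ => (hd x).hasDerivWithinAt) (fun x hx => by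
      have hx' := abs_le.2 hx
      have h1 := abs_rpow_mul_self_sub_le hp (s := x) (t := a + x) (M := 2 * M) (by linarith)
        ((abs_add_le a x).trans (by linarith))
      rw [add_sub_cancel_right] at h1
      rw [Real.norm_eq_abs, ← mul_sub, abs_mul, abs_of_nonneg (by linarith : 0 ≤ p + 2), mul_assoc]
      gcongr) (x := 0) (y := b) ⟨by linarith, hM⟩ (abs_le.1 hb)
  simp only [Real.norm_eq_abs, add_zero, abs_zero, sub_zero] at this
  rw [Real.zero_rpow (by linarith), sub_zero] at this
  rw [sub_right_comm, ← mul_assoc]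
  exact this

/-- First-order Taylor expansion: after removing the linear term, the derivative in `s` is `O(|b|)`
on `[-|b|, |b|]`. -/
theorem abs_add_rpow_sub_sub_mul_le (hp : 1 < p) {M a b : ℝ} (ha : |a| ≤ M) (hb : |b| ≤ M) :
    |(|a + b| ^ (p + 2) - |a| ^ (p + 2) - (p + 2) * (|a| ^ p * a) * b)|
      ≤ (p + 2) * ((p + 1) * (2 * M) ^ p) * b ^ 2 := by
  have hM : 0 ≤ M := (abs_nonneg a).trans ha
  have hd : ∀ x, HasDerivAt (fun s : ℝ => |a + s| ^ (p + 2) - (p + 2) * (|a| ^ p * a) * s)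
      ((p + 2) * (|a + x| ^ p * (a + x)) - (p + 2) * (|a| ^ p * a)) x := fun x =>
    ((hasDerivAt_abs_rpow_add_two hp (a + x)).comp_const_add a x).sub
      (by simpa using! (hasDerivAt_id x).const_mul ((p + 2) * (|a| ^ p * a)))
  have := (convex_Icc (-|b|) |b|).norm_image_sub_le_of_norm_hasDerivWithin_le
    (C := (p + 2) * ((p + 1) * (2 * M) ^ p) * |b|)
    (fun x _ => (hd x).hasDerivWithinAt) (fun x hx => by
      have hx' := abs_le.2 hx
      have h1 := abs_rpow_mul_self_sub_le hp (s := a) (t := a + x) (M := 2 * M) (by linarith)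
        ((abs_add_le a x).trans (by linarith))
      rw [add_sub_cancel_left] at h1
      rw [Real.norm_eq_abs, ← mul_sub, abs_mul, abs_of_nonneg (by linarith : 0 ≤ p + 2), mul_assoc]
      gcongr
      refine h1.trans ?_
      gcongr) (x := 0) (y := b) ⟨by simp, abs_nonneg b⟩ (abs_le.1 le_rfl)
  simp only [Real.norm_eq_abs, add_zero, mul_zero, sub_zero] at this
  rw [sub_right_comm, ← sq_abs b, sq]
  exact this.trans_eq (mul_assoc _ _ _)

theorem abs_rpow_add_two_le (hp : 1 < p) {M a : ℝ} (ha : |a| ≤ M) :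
    |a| ^ (p + 2) ≤ M ^ p * a ^ 2 := by
  rw [Real.rpow_add_of_nonneg (abs_nonneg a) (by linarith) (by norm_num), Real.rpow_two, sq_abs]
  have := Real.rpow_le_rpow (abs_nonneg a) ha (by linarith : 0 ≤ p)
  gcongr

theorem integrable_abs_rpow (hp : 1 < p) {f : ℝ → ℝ} (hf : MemLp f 2) {M : ℝ}
    (hM : ∀ x, |f x| ≤ M) : Integrable (fun x => |f x| ^ (p + 2)) := by
  refine (hf.integrable_sq.const_mul (M ^ p)).mono' ?_
    (Eventually.of_forall fun x => ?_)
  · exact ((hf.1.aemeasurable.abs).pow_const _).aestronglyMeasurable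
  · rw [Real.norm_of_nonneg (by positivity)]
    exact abs_rpow_add_two_le hp (hM x)

/-- If `f n` is bounded in `L²`, tends to `0` pointwise, and `g ∈ L²`, then
`∫ |f n| |g| → 0`. -/
theorem tendsto_integral_abs_mul_abs {f : ℕ → ℝ → ℝ} {g : ℝ → ℝ} (hf : ∀ n, MemLp (f n) 2)
    (hg : MemLp g 2) {M : ℝ} (hM : ∀ n, ∫ x, f n x ^ 2 ≤ M)
    (h0 : ∀ x, Tendsto (fun n => f n x) atTop (𝓝 0)) :
    Tendsto (fun n => ∫ x, |f n x| * |g x|) atTop (𝓝 0) := by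
  have hM0 : 0 ≤ M := (integral_nonneg fun x => sq_nonneg _).trans (hM 0)
  have hi : ∀ n, Integrable (fun x => |f n x| * |g x|) := fun n =>
    integrable_mul_of_memLp (hf n).abs hg.abs
  rw [Metric.tendsto_atTop]
  intro e he
  set ε : ℝ := e / (2 * (M + 1)) with hε
  have hε0 : 0 < ε := by positivity
  -- By Young's inequality `r n ≤ g² / (4ε)`, so dominated convergence applies; the discarded part
  -- has integral at most `εM < e/2`.
  let r : ℕ → ℝ → ℝ := fun n x => max (|f n x| * |g x| - ε * f n x ^ 2) 0
  have hri : ∀ n, Integrable (r n) := fun n =>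
    ((hi n).sub ((hf n).integrable_sq.const_mul ε)).pos_part
  have hr : Tendsto (fun n => ∫ x, r n x) atTop (𝓝 (∫ _ : ℝ, (0 : ℝ))) := by
    refine tendsto_integral_of_dominated_convergence (fun x => (4 * ε)⁻¹ * g x ^ 2)
      (fun n => (hri n).1) (hg.integrable_sq.const_mul _) (fun n => Eventually.of_forall fun x => ?_)
      (Eventually.of_forall fun x => ?_)
    · rw [Real.norm_of_nonneg (le_max_right _ _)]
      refine max_le ?_ (by positivity)
      rw [inv_mul_eq_div, le_div_iff₀ (by positivity), ← sq_abs (f n x), ← sq_abs (g x)]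
      nlinarith [sq_nonneg (2 * ε * |f n x| - |g x|)]
    · have h1 := h0 x
      have h2 := ((h1.abs.mul_const |g x|).sub ((h1.pow 2).const_mul ε)).max
        (tendsto_const_nhds (x := (0 : ℝ)))
      simpa using h2
  simp only [integral_zero] at hr
  obtain ⟨N, hN⟩ := (Metric.tendsto_atTop.1 hr) (e / 2) (by linarith)
  refine ⟨N, fun n hn => ?_⟩
  have h1 := hN n hn
  rw [Real.dist_eq, sub_zero] at h1 ⊢
  rw [abs_of_nonneg (integral_nonneg fun x => by positivity)]
  have h2 : ∫ x, |f n x| * |g x| ≤ ∫ x, (r n x + ε * f n x ^ 2) :=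
    integral_mono (hi n) ((hri n).add ((hf n).integrable_sq.const_mul ε)) fun x => by
      have := le_max_left (|f n x| * |g x| - ε * f n x ^ 2) 0
      simp only [r]
      linarith
  rw [integral_add (hri n) ((hf n).integrable_sq.const_mul ε), integral_const_mul] at h2
  have h3 : ε * ∫ x, f n x ^ 2 ≤ ε * M := by
    have := hM n
    gcongr
  have h4 : ε * M < e / 2 := by
    rw [hε, div_mul_eq_mul_div, div_lt_div_iff₀ (by positivity) (by norm_num)]
    nlinarith
  linarith [le_abs_self (∫ x, r n x)]

/-- The Brezis-Lieb splitting of `∫ |f|^{p+2}` for uniformly bounded functions. -/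
theorem tendsto_integral_abs_rpow_sub (hp : 1 < p) {f : ℕ → ℝ → ℝ} {g : ℝ → ℝ}
    (hf : ∀ n, MemLp (f n) 2) (hg : MemLp g 2) {M K : ℝ} (hM : ∀ n, ∫ x, f n x ^ 2 ≤ M)
    (hK : ∀ n x, |f n x| ≤ K) (hgK : ∀ x, |g x| ≤ K)
    (h0 : ∀ x, Tendsto (fun n => f n x) atTop (𝓝 0)) :
    Tendsto (fun n => (∫ x, |f n x + g x| ^ (p + 2)) - ∫ x, |f n x| ^ (p + 2)) atTop
      (𝓝 (∫ x, |g x| ^ (p + 2))) := by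
  set C : ℝ := (p + 2) * ((p + 1) * (2 * K) ^ p)
  have h1 := (tendsto_integral_abs_mul_abs hf hg hM h0).const_mul C
  rw [mul_zero] at h1
  have i1 : ∀ n, Integrable (fun x => |f n x + g x| ^ (p + 2)) := fun n =>
    integrable_abs_rpow hp ((hf n).add hg) (M := K + K)
      fun x => (abs_add_le _ _).trans (add_le_add (hK n x) (hgK x))
  have i2 : ∀ n, Integrable (fun x => |f n x| ^ (p + 2)) := fun n =>
    integrable_abs_rpow hp (hf n) (hK n)
  have i3 := integrable_abs_rpow hp hg hgK
  rw [tendsto_iff_norm_sub_tendsto_zero]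
  refine squeeze_zero (fun n => norm_nonneg _) (fun n => ?_) h1
  have e : (∫ x, |f n x + g x| ^ (p + 2)) - (∫ x, |f n x| ^ (p + 2)) - ∫ x, |g x| ^ (p + 2)
      = ∫ x, (|f n x + g x| ^ (p + 2) - |f n x| ^ (p + 2) - |g x| ^ (p + 2)) := by
    rw [integral_sub (f := fun x => |f n x + g x| ^ (p + 2) - |f n x| ^ (p + 2))
      ((i1 n).sub (i2 n)) i3, integral_sub (i1 n) (i2 n)]
  rw [e, ← integral_const_mul]
  refine norm_integral_le_of_norm_le
    ((integrable_mul_of_memLp (hf n).abs hg.abs).const_mul C) (Eventually.of_forall fun x => ?_)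
  exact abs_add_rpow_sub_sub_le hp (hK n x) (hgK x)

end Power

/-! ### Compactness of minimizing sequences -/

section Compactness

variable {p : ℝ}

theorem IsH2.abs_le {U V W : ℝ → ℝ} (h : IsH2 U V W) {M : ℝ}
    (hM : ∫ x, (U x ^ 2 + V x ^ 2 + W x ^ 2) ≤ M) (x : ℝ) : |U x| ≤ √(2 * M) := by
  refine Real.abs_le_sqrt ((h.4.sq_le_integral h.1 h.2 x).trans ?_)
  have : ∫ y, (U y ^ 2 + V y ^ 2) ≤ ∫ y, (U y ^ 2 + V y ^ 2 + W y ^ 2) :=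
    integral_mono (h.1.integrable_sq.add h.2.integrable_sq)
      ((h.1.integrable_sq.add h.2.integrable_sq).add h.3.integrable_sq)
      fun x => by simp only; linarith [sq_nonneg (W x)]
  linarith

theorem IsH2.integral_sq_le {U V W : ℝ → ℝ} (h : IsH2 U V W) :
    ∫ x, U x ^ 2 ≤ ∫ x, (U x ^ 2 + V x ^ 2 + W x ^ 2) :=
  integral_mono h.1.integrable_sq
    ((h.1.integrable_sq.add h.2.integrable_sq).add h.3.integrable_sq)
    fun x => by simp only; nlinarith [sq_nonneg (W x), sq_nonneg (V x)]

theorem IsH2.integrable_abs_rpow {U V W : ℝ → ℝ} (h : IsH2 U V W) (hp : 1 < p) :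
    Integrable (fun x => |U x| ^ (p + 2)) :=
  Boussinesq.integrable_abs_rpow hp h.1 (h.abs_le le_rfl)

theorem IsH2.mem_admissible_iff {U V W u : ℝ → ℝ} (h : IsH2 U V W) (hu : u =ᵐ[volume] U)
    (hp : 1 < p) : u ∈ admissible p ↔ ∫ x, |U x| ^ (p + 2) = 1 := by
  have hq : (ENNReal.ofReal (p + 2)).toReal = p + 2 := ENNReal.toReal_ofReal (by linarith)
  have hq0 : ENNReal.ofReal (p + 2) ≠ 0 := by
    rw [Ne, ENNReal.ofReal_eq_zero, not_le]; linarith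
  have hL : MemLp U (ENNReal.ofReal (p + 2)) := by
    rw [← integrable_norm_rpow_iff h.1.1 hq0 ENNReal.ofReal_ne_top, hq]
    simpa using h.integrable_abs_rpow hp
  have hpos : 0 ≤ ∫ x, |U x| ^ (p + 2) := integral_nonneg fun x => by positivity
  simp only [admissible, Set.mem_ofPred_eq, h.memH2 hu, true_and]
  rw [eLpNorm_congr_ae hu, hL.eLpNorm_eq_integral_rpow_norm hq0 ENNReal.ofReal_ne_top, hq,
    ENNReal.ofReal_eq_one]
  simp only [Real.norm_eq_abs]
  rw [Real.rpow_inv_eq hpos zero_le_one (by linarith), Real.one_rpow]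

/-- `m (∫ |U|^{p+2})^{2/(p+2)}` bounds the energy from below, once `m` does so on the constraint
set. -/
theorem IsH2.mul_rpow_le_energy (hp : 1 < p) {a b d m : ℝ}
    (hpos : ∀ U V W : ℝ → ℝ, IsH2 U V W → 0 ≤ ∫ x, (a * W x ^ 2 + b * V x ^ 2 + d * U x ^ 2))
    (hm : ∀ U V W : ℝ → ℝ, IsH2 U V W → ∫ x, |U x| ^ (p + 2) = 1 →
      m ≤ ∫ x, (a * W x ^ 2 + b * V x ^ 2 + d * U x ^ 2))
    {U V W : ℝ → ℝ} (h : IsH2 U V W) :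
    m * (∫ x, |U x| ^ (p + 2)) ^ (2 / (p + 2))
      ≤ ∫ x, (a * W x ^ 2 + b * V x ^ 2 + d * U x ^ 2) := by
  have hq : 0 < p + 2 := by linarith
  set N : ℝ := ∫ x, |U x| ^ (p + 2) with hN
  have hN0 : 0 ≤ N := integral_nonneg fun x => by positivity
  rcases hN0.eq_or_lt with h0 | h0
  · rw [← h0, Real.zero_rpow (by positivity), mul_zero]
    exact hpos U V W h
  -- The factor that normalizes `U` in `L^{p+2}`; the energy scales by `s²`.
  set s : ℝ := N ^ (-(1 / (p + 2))) with hs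
  have hs0 : 0 < s := Real.rpow_pos_of_pos h0 _
  have hsq : s ^ (p + 2) = N⁻¹ := by
    rw [hs, ← Real.rpow_mul hN0, ← Real.rpow_neg_one]
    congr 1; field_simp
  have h1 := hm _ _ _ (h.const_mul s) (by
    simp only [abs_mul, abs_of_pos hs0]
    simp only [Real.mul_rpow hs0.le (abs_nonneg _)]
    rw [integral_const_mul, hsq, ← hN, inv_mul_cancel₀ h0.ne'])
  have h2 : ∫ x, (a * (s * W x) ^ 2 + b * (s * V x) ^ 2 + d * (s * U x) ^ 2)
      = s ^ 2 * ∫ x, (a * W x ^ 2 + b * V x ^ 2 + d * U x ^ 2) := by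
    rw [← integral_const_mul]
    congr 1; ext x; ring
  rw [h2] at h1
  have h3 : s ^ 2 * N ^ (2 / (p + 2)) = 1 := by
    rw [hs, ← Real.rpow_natCast, ← Real.rpow_mul hN0, ← Real.rpow_add h0]
    rw [show -(1 / (p + 2)) * ((2 : ℕ) : ℝ) + 2 / (p + 2) = 0 by push_cast; ring, Real.rpow_zero]
  have h4 : 0 < N ^ (2 / (p + 2)) := Real.rpow_pos_of_pos h0 _
  calc m * N ^ (2 / (p + 2))
      ≤ (s ^ 2 * ∫ x, (a * W x ^ 2 + b * V x ^ 2 + d * U x ^ 2)) * N ^ (2 / (p + 2)) := by gcongr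
    _ = (s ^ 2 * N ^ (2 / (p + 2))) * ∫ x, (a * W x ^ 2 + b * V x ^ 2 + d * U x ^ 2) := by ring
    _ = _ := by rw [h3, one_mul]

/-- For `0 < t < 1` and `r < 1` one has `t < t^r`, so a genuine splitting would make the sum exceed
`1`. This rules out dichotomy. -/
theorem eq_one_of_rpow_add_rpow_le {r l : ℝ} (hr1 : r < 1) (hl : 0 < l) (hl1 : l ≤ 1)
    (h : l ^ r + (1 - l) ^ r ≤ 1) : l = 1 := by
  by_contra hne
  have hlt : l < 1 := lt_of_le_of_ne hl1 hne
  have h1 : l ^ (1 : ℝ) < l ^ r := Real.rpow_lt_rpow_of_exponent_gt hl hlt hr1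
  have h2 : (1 - l) ^ (1 : ℝ) < (1 - l) ^ r :=
    Real.rpow_lt_rpow_of_exponent_gt (by linarith) (by linarith) hr1
  rw [Real.rpow_one] at h1 h2
  linarith

/-- A function in the constraint set which is small in `L²` is large somewhere. -/
theorem IsH2.exists_le_abs (hp : 1 < p) {U V W : ℝ → ℝ} (h : IsH2 U V W)
    (h1 : ∫ x, |U x| ^ (p + 2) = 1) {M η : ℝ} (hM : ∫ x, U x ^ 2 ≤ M) (hη : 0 < η)
    (hηM : η ^ p * M < 1) : ∃ y, η ≤ |U y| := by
  by_contra! hlt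
  have h2 : ∫ x, |U x| ^ (p + 2) ≤ η ^ p * ∫ x, U x ^ 2 := by
    rw [← integral_const_mul]
    exact integral_mono (h.integrable_abs_rpow hp) (h.1.integrable_sq.const_mul _)
      fun x => abs_rpow_add_two_le hp (hlt x).le
  have h3 : η ^ p * ∫ x, U x ^ 2 ≤ η ^ p * M := by gcongr
  linarith

/-- Polarization: the cross term is linear in `(U, V, W)`, hence passes to weak limits. -/
theorem energy_sub_eq {a b d : ℝ} {U V W U' V' W' : ℝ → ℝ} (h : IsH2 U V W)
    (h' : IsH2 U' V' W') :
    ∫ x, (a * (W x - W' x) ^ 2 + b * (V x - V' x) ^ 2 + d * (U x - U' x) ^ 2)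
      = (∫ x, (a * W x ^ 2 + b * V x ^ 2 + d * U x ^ 2))
        - 2 * (a * (∫ x, W x * W' x) + b * (∫ x, V x * V' x) + d * ∫ x, U x * U' x)
        + ∫ x, (a * W' x ^ 2 + b * V' x ^ 2 + d * U' x ^ 2) := by
  have i1 := integrable_mul_of_memLp h.1 h'.1
  have i2 := integrable_mul_of_memLp h.2 h'.2
  have i3 := integrable_mul_of_memLp h.3 h'.3
  have iB : Integrable (fun x => 2 * (a * (W x * W' x) + b * (V x * V' x) + d * (U x * U' x))) :=
    (((i3.const_mul a).add (i2.const_mul b)).add (i1.const_mul d)).const_mul 2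
  have iE := h.integrable_energy a b d
  have iEB : Integrable (fun x => a * W x ^ 2 + b * V x ^ 2 + d * U x ^ 2
      - 2 * (a * (W x * W' x) + b * (V x * V' x) + d * (U x * U' x))) := iE.sub iB
  rw [← integral_lincomb i3 i2 i1, ← integral_const_mul, ← integral_sub iE iB,
    ← integral_add iEB (h'.integrable_energy a b d)]
  congr 1
  ext x
  ring

/-- Minimizing sequences are, up to translations, relatively compact. -/
theorem exists_convergent_subseq (hp : 1 < p) {a b d m δ : ℝ} (hδ : 0 < δ)
    (hco : ∀ U V W : ℝ → ℝ, IsH2 U V W → δ * ∫ x, (U x ^ 2 + V x ^ 2 + W x ^ 2)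
        ≤ ∫ x, (a * W x ^ 2 + b * V x ^ 2 + d * U x ^ 2))
    (hm : ∀ U V W : ℝ → ℝ, IsH2 U V W → ∫ x, |U x| ^ (p + 2) = 1 →
      m ≤ ∫ x, (a * W x ^ 2 + b * V x ^ 2 + d * U x ^ 2))
    {U V W : ℕ → ℝ → ℝ} (h : ∀ n, IsH2 (U n) (V n) (W n))
    (h1 : ∀ n, ∫ x, |U n x| ^ (p + 2) = 1)
    (hlim : Tendsto (fun n => ∫ x, (a * W n x ^ 2 + b * V n x ^ 2 + d * U n x ^ 2)) atTop (𝓝 m)) :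
    ∃ (k : ℕ → ℕ) (y : ℕ → ℝ) (u v w : ℝ → ℝ), StrictMono k ∧ 0 < m ∧ IsH2 u v w ∧
      ∫ x, |u x| ^ (p + 2) = 1 ∧ ∫ x, (a * w x ^ 2 + b * v x ^ 2 + d * u x ^ 2) = m ∧
      Tendsto (fun n => ∫ x, ((U (k n) (x + y n) - u x) ^ 2 + (V (k n) (x + y n) - v x) ^ 2
        + (W (k n) (x + y n) - w x) ^ 2)) atTop (𝓝 0) := by
  have hnn : ∀ U V W : ℝ → ℝ, 0 ≤ ∫ x, (U x ^ 2 + V x ^ 2 + W x ^ 2) := fun U V W =>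
    integral_nonneg fun x => by positivity
  have hpos : ∀ U V W : ℝ → ℝ, IsH2 U V W →
      0 ≤ ∫ x, (a * W x ^ 2 + b * V x ^ 2 + d * U x ^ 2) := fun U V W h =>
    (mul_nonneg hδ.le (hnn U V W)).trans (hco U V W h)
  obtain ⟨K, hK⟩ := hlim.bddAbove_range
  set M : ℝ := K / δ with hMdef
  have hM : ∀ n, ∫ x, (U n x ^ 2 + V n x ^ 2 + W n x ^ 2) ≤ M := fun n => by
    rw [hMdef, le_div_iff₀ hδ, mul_comm]
    exact (hco _ _ _ (h n)).trans (hK ⟨n, rfl⟩)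
  have hM0 : 0 ≤ M := (hnn _ _ _).trans (hM 0)
  -- If `m ≤ 0`, some term has squared `H²` norm below `1/2`, so its sup norm is below `1`; yet the
  -- constraint then forces a value of modulus at least `1`.
  have hm0 : 0 < m := by
    by_contra! hm0
    obtain ⟨n, hn⟩ := ((tendsto_order.1 hlim).2 (δ / 2) (by linarith)).exists
    have hn' : ∫ x, (U n x ^ 2 + V n x ^ 2 + W n x ^ 2) < 1 / 2 := by
      have := (hco _ _ _ (h n)).trans_lt hn
      by_contra! hge
      nlinarith
    obtain ⟨y, hy⟩ := (h n).exists_le_abs hp (h1 n) ((h n).integral_sq_le.trans hn'.le)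
      one_pos (by norm_num)
    have h3 : √(2 * ∫ x, (U n x ^ 2 + V n x ^ 2 + W n x ^ 2)) < 1 := by
      rw [Real.sqrt_lt' one_pos]
      linarith
    linarith [(h n).abs_le le_rfl y]
  obtain ⟨η, hη0, hη⟩ : ∃ η : ℝ, 0 < η ∧ η ^ p * M < 1 := by
    refine ⟨(M + 1)⁻¹, by positivity, ?_⟩
    have h2 : (M + 1)⁻¹ ^ p ≤ (M + 1)⁻¹ := by
      have := Real.rpow_le_rpow_of_exponent_ge (x := (M + 1)⁻¹) (by positivity)
        (inv_le_one_of_one_le₀ (by linarith)) hp.le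
      rwa [Real.rpow_one] at this
    calc (M + 1)⁻¹ ^ p * M ≤ (M + 1)⁻¹ * M := by gcongr
      _ < 1 := by rw [inv_mul_lt_iff₀ (by positivity)]; linarith
  have hex : ∀ n, ∃ y, η ≤ |U n y| := fun n =>
    (h n).exists_le_abs hp (h1 n) ((h n).integral_sq_le.trans (hM n)) hη0 hη
  -- Translating by `z n` puts a value of modulus at least `η` at the origin, which prevents
  -- vanishing.
  choose z hz using hex
  have hT : ∀ n, IsH2 (fun x => U n (x + z n)) (fun x => V n (x + z n)) (fun x => W n (x + z n)) :=
    fun n => (h n).comp_add_right (z n)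
  have hTM : ∀ n, ∫ x, (U n (x + z n) ^ 2 + V n (x + z n) ^ 2 + W n (x + z n) ^ 2) ≤ M := fun n => by
    rw [integral_add_right_eq_self (fun x => U n x ^ 2 + V n x ^ 2 + W n x ^ 2) (z n)]
    exact hM n
  obtain ⟨k, u, v, w, hk, hH, wu, wv, ww, hpt⟩ := exists_weakly_convergent_subseq_H2 hT hTM
  have hT1 : ∀ n, ∫ x, |U (k n) (x + z (k n))| ^ (p + 2) = 1 := fun n => by
    rw [integral_add_right_eq_self (fun x => |U (k n) x| ^ (p + 2)), h1]
  have hE : Tendsto (fun n => ∫ x, (a * W (k n) (x + z (k n)) ^ 2 + b * V (k n) (x + z (k n)) ^ 2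
      + d * U (k n) (x + z (k n)) ^ 2)) atTop (𝓝 m) := by
    refine (hlim.comp hk.tendsto_atTop).congr fun n => ?_
    rw [integral_add_right_eq_self
      (fun x => a * W (k n) x ^ 2 + b * V (k n) x ^ 2 + d * U (k n) x ^ 2)]
    rfl
  set Eu : ℝ := ∫ x, (a * w x ^ 2 + b * v x ^ 2 + d * u x ^ 2) with hEu
  have hD : ∀ n, IsH2 (fun x => U (k n) (x + z (k n)) - u x) (fun x => V (k n) (x + z (k n)) - v x)
      (fun x => W (k n) (x + z (k n)) - w x) := fun n => (hT (k n)).sub hH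
  have hED : Tendsto (fun n => ∫ x, (a * (W (k n) (x + z (k n)) - w x) ^ 2
      + b * (V (k n) (x + z (k n)) - v x) ^ 2
      + d * (U (k n) (x + z (k n)) - u x) ^ 2)) atTop (𝓝 (m - Eu)) := by
    have h2 := (((ww w hH.3).const_mul a).add ((wv v hH.2).const_mul b)).add
      ((wu u hH.1).const_mul d)
    have h3 := (hE.sub (h2.const_mul 2)).add_const Eu
    have h4 : m - 2 * (a * (∫ x, w x * w x) + b * (∫ x, v x * v x) + d * ∫ x, u x * u x) + Eu
        = m - Eu := by
      rw [hEu, integral_lincomb hH.3.integrable_sq hH.2.integrable_sq hH.1.integrable_sq]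
      simp only [sq]
      ring
    rw [h4] at h3
    exact h3.congr fun n => (energy_sub_eq (hT (k n)) hH).symm
  set l : ℝ := ∫ x, |u x| ^ (p + 2) with hl
  -- Pointwise convergence keeps `|u 0| ≥ η`, and continuity gives the support positive measure.
  have hl0 : 0 < l := by
    have hu0 : η ≤ |u 0| := ge_of_tendsto' (hpt 0).abs fun n => by simpa using hz (k n)
    have hcont : Continuous fun x => |u x| ^ (p + 2) :=
      hH.continuous.abs.rpow_const fun x => Or.inr (by linarith)
    rw [hl, integral_pos_iff_support_of_nonneg (fun x => by positivity) (hH.integrable_abs_rpow hp)]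
    refine hcont.isOpen_support.measure_pos volume ⟨0, ?_⟩
    rw [Function.mem_support]
    have : 0 < |u 0| := hη0.trans_le hu0
    positivity
  have hBL : Tendsto (fun n => ∫ x, |U (k n) (x + z (k n)) - u x| ^ (p + 2)) atTop (𝓝 (1 - l)) := by
    have hub : ∀ n, ∫ x, (U (k n) (x + z (k n)) - u x) ^ 2 ≤ 2 * M + 2 * ∫ x, u x ^ 2 := fun n => by
      have h2 : ∫ x, (U (k n) (x + z (k n)) - u x) ^ 2
          ≤ ∫ x, (2 * U (k n) (x + z (k n)) ^ 2 + 2 * u x ^ 2) :=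
        integral_mono (hD n).1.integrable_sq
          (((hT (k n)).1.integrable_sq.const_mul 2).add (hH.1.integrable_sq.const_mul 2))
          fun x => by simp only; nlinarith [sq_nonneg (U (k n) (x + z (k n)) + u x)]
      rw [integral_add ((hT (k n)).1.integrable_sq.const_mul 2) (hH.1.integrable_sq.const_mul 2),
        integral_const_mul, integral_const_mul] at h2
      have h3 := (hT (k n)).integral_sq_le.trans (hTM (k n))
      linarith
    have hUb : ∀ n x, |U (k n) (x + z (k n))| ≤ √(2 * M) := fun n x =>
      (hT (k n)).abs_le (hTM (k n)) x
    have hub' : ∀ x, |u x| ≤ √(2 * M) := fun x =>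
      le_of_tendsto' (hpt x).abs fun n => hUb n x
    have h2 := tendsto_integral_abs_rpow_sub hp (fun n => (hD n).1) hH.1 hub
      (K := √(2 * M) + √(2 * M))
      (fun n x => (abs_sub _ _).trans (add_le_add (hUb n x) (hub' x)))
      (fun x => (hub' x).trans (by linarith [Real.sqrt_nonneg (2 * M)]))
      (fun x => by simpa using (hpt x).sub_const (u x))
    have h3 := (tendsto_const_nhds (x := (1 : ℝ))).sub h2
    refine h3.congr fun n => ?_
    simp only [sub_add_cancel]
    rw [hT1]
    ring
  have hl1 : 0 ≤ 1 - l := ge_of_tendsto' hBL fun n => integral_nonneg fun x => by positivity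
  have hr : 0 < 2 / (p + 2) := by apply div_pos <;> linarith
  have hr1 : 2 / (p + 2) < 1 := by rw [div_lt_one] <;> linarith
  -- The homogeneous lower bound is used for the limit and then for the remainder; the two
  -- right-hand sides add up to `m`.
  have hlow1 : m * l ^ (2 / (p + 2)) ≤ Eu := hH.mul_rpow_le_energy hp hpos hm
  have hlow2 : m * (1 - l) ^ (2 / (p + 2)) ≤ m - Eu :=
    le_of_tendsto_of_tendsto' ((hBL.rpow_const (Or.inr hr.le)).const_mul m) hED
      fun n => (hD n).mul_rpow_le_energy hp hpos hm
  have hl_eq : l = 1 := by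
    refine eq_one_of_rpow_add_rpow_le hr1 hl0 (by linarith) ?_
    have : m * (l ^ (2 / (p + 2)) + (1 - l) ^ (2 / (p + 2))) ≤ m * 1 := by linarith
    exact le_of_mul_le_mul_left this hm0
  have hEum : Eu = m := by
    rw [hl_eq, Real.one_rpow, mul_one] at hlow1
    have := ge_of_tendsto' hED fun n => hpos _ _ _ (hD n)
    linarith
  refine ⟨k, fun n => z (k n), u, v, w, hk, hm0, hH, hl_eq, hEum, ?_⟩
  have h2 := hED.const_mul δ⁻¹
  rw [hEum, sub_self, mul_zero] at h2
  refine squeeze_zero (fun n => hnn _ _ _) (fun n => ?_) h2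
  rw [le_inv_mul_iff₀ hδ]
  exact hco _ _ _ (hD n)

end Compactness

/-! ### The Euler-Lagrange equation -/

section EulerLagrange

variable {p : ℝ}

theorem hasDerivAt_zero_of_abs_le {f : ℝ → ℝ} {D C : ℝ}
    (h : ∀ t, |t| ≤ 1 → |f t - f 0 - t * D| ≤ C * t ^ 2) : HasDerivAt f D 0 := by
  rw [hasDerivAt_iff_isLittleO_nhds_zero]
  refine Asymptotics.IsBigO.trans_isLittleO (g := fun t : ℝ => t ^ 2) ?_
    (Asymptotics.isLittleO_pow_id one_lt_two)
  refine Asymptotics.IsBigO.of_bound C ?_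
  filter_upwards [Metric.closedBall_mem_nhds (0 : ℝ) one_pos] with t ht
  have ht' : |t| ≤ 1 := by simpa using ht
  have := h t ht'
  simp only [zero_add, smul_eq_mul, Real.norm_eq_abs, abs_pow, sq_abs]
  exact this

theorem IsH2.memLp_nonlinearity {U V W : ℝ → ℝ} (h : IsH2 U V W) (hp : 1 < p) :
    MemLp (fun x => |U x| ^ p * U x) 2 := by
  obtain ⟨M, hM⟩ : ∃ M, ∀ x, |U x| ≤ M := ⟨_, h.abs_le le_rfl⟩
  have hc : Continuous fun x => |U x| ^ p * U x :=
    (h.continuous.abs.rpow_const fun x => Or.inr (by linarith)).mul h.continuous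
  refine h.1.of_le_mul (c := M ^ p) hc.aestronglyMeasurable (Eventually.of_forall fun x => ?_)
  rw [norm_mul, Real.norm_of_nonneg (by positivity)]
  have := Real.rpow_le_rpow (abs_nonneg _) (hM x) (by linarith : 0 ≤ p)
  gcongr

/-- The pointwise Taylor bound integrates to an error `O(t²) ∫ Φ²`, uniform for `|t| ≤ 1`. -/
theorem IsH2.hasDerivAt_integral_abs_rpow {U V W Φ Φ' Φ'' : ℝ → ℝ} (h : IsH2 U V W)
    (hΦ : IsH2 Φ Φ' Φ'') (hp : 1 < p) :
    HasDerivAt (fun t : ℝ => ∫ x, |U x + t * Φ x| ^ (p + 2))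
      ((p + 2) * ∫ x, |U x| ^ p * U x * Φ x) 0 := by
  obtain ⟨M₁, hM₁⟩ : ∃ M, ∀ x, |U x| ≤ M := ⟨_, h.abs_le le_rfl⟩
  obtain ⟨M₂, hM₂⟩ : ∃ M, ∀ x, |Φ x| ≤ M := ⟨_, hΦ.abs_le le_rfl⟩
  set M : ℝ := max M₁ M₂
  set C : ℝ := (p + 2) * ((p + 1) * (2 * M) ^ p)
  have iL := integrable_mul_of_memLp (h.memLp_nonlinearity hp) hΦ.1
  refine hasDerivAt_zero_of_abs_le (C := C * ∫ x, Φ x ^ 2) fun t ht => ?_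
  have i0 := h.integrable_abs_rpow hp
  have i1 := (h.add (hΦ.const_mul t)).integrable_abs_rpow hp
  have e : (∫ x, |U x + t * Φ x| ^ (p + 2)) - (∫ x, |U x + 0 * Φ x| ^ (p + 2))
      - t * ((p + 2) * ∫ x, |U x| ^ p * U x * Φ x)
      = ∫ x, (|U x + t * Φ x| ^ (p + 2) - |U x| ^ (p + 2)
        - (p + 2) * (|U x| ^ p * U x) * (t * Φ x)) := by
    have i2 : Integrable (fun x => |U x + t * Φ x| ^ (p + 2) - |U x| ^ (p + 2)) := i1.sub i0
    have e1 : ∀ x, (p + 2) * (|U x| ^ p * U x) * (t * Φ x)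
        = t * (p + 2) * (|U x| ^ p * U x * Φ x) := fun x => by ring
    simp only [e1, zero_mul, add_zero]
    rw [integral_sub i2 (iL.const_mul _), integral_sub i1 i0, integral_const_mul]
    ring
  rw [e, mul_assoc, ← integral_mul_const, ← integral_const_mul, ← Real.norm_eq_abs]
  refine norm_integral_le_of_norm_le ((hΦ.1.integrable_sq.mul_const _).const_mul _)
    (Eventually.of_forall fun x => ?_)
  have hb : |t * Φ x| ≤ M := by
    rw [abs_mul]
    calc |t| * |Φ x| ≤ 1 * |Φ x| := by gcongr
      _ ≤ M := by rw [one_mul]; exact (hM₂ x).trans (le_max_right _ _)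
  refine (abs_add_rpow_sub_sub_mul_le hp ((hM₁ x).trans (le_max_left _ _)) hb).trans_eq ?_
  ring

theorem energy_add_mul_eq {a b d : ℝ} {U V W U' V' W' : ℝ → ℝ} (h : IsH2 U V W)
    (h' : IsH2 U' V' W') (t : ℝ) :
    ∫ x, (a * (W x + t * W' x) ^ 2 + b * (V x + t * V' x) ^ 2 + d * (U x + t * U' x) ^ 2)
      = (∫ x, (a * W x ^ 2 + b * V x ^ 2 + d * U x ^ 2))
        + 2 * t * (a * (∫ x, W x * W' x) + b * (∫ x, V x * V' x) + d * ∫ x, U x * U' x)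
        + t ^ 2 * ∫ x, (a * W' x ^ 2 + b * V' x ^ 2 + d * U' x ^ 2) := by
  have := energy_sub_eq (a := a) (b := b) (d := d) h (h'.const_mul (-t))
  simp only [mul_left_comm _ (-t), integral_const_mul, mul_pow] at this
  simp only [neg_mul, sub_neg_eq_add, even_two, Even.neg_pow] at this
  have e : ∫ x, (a * (t ^ 2 * W' x ^ 2) + b * (t ^ 2 * V' x ^ 2) + d * (t ^ 2 * U' x ^ 2))
      = t ^ 2 * ∫ x, (a * W' x ^ 2 + b * V' x ^ 2 + d * U' x ^ 2) := by
    rw [← integral_const_mul]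
    congr 1; ext x; ring
  rw [this, e]
  ring

/-- Minimizers satisfy the weak Euler-Lagrange equation. -/
theorem IsH2.euler_lagrange (hp : 1 < p) {a b d m : ℝ}
    (hm : ∀ U V W : ℝ → ℝ, IsH2 U V W → m * (∫ x, |U x| ^ (p + 2)) ^ (2 / (p + 2))
      ≤ ∫ x, (a * W x ^ 2 + b * V x ^ 2 + d * U x ^ 2))
    {U V W Φ Φ' Φ'' : ℝ → ℝ} (h : IsH2 U V W) (h1 : ∫ x, |U x| ^ (p + 2) = 1)
    (hE : ∫ x, (a * W x ^ 2 + b * V x ^ 2 + d * U x ^ 2) = m) (hΦ : IsH2 Φ Φ' Φ'') :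
    a * (∫ x, W x * Φ'' x) + b * (∫ x, V x * Φ' x) + d * (∫ x, U x * Φ x)
      = m * ∫ x, |U x| ^ p * U x * Φ x := by
  set B : ℝ := a * (∫ x, W x * Φ'' x) + b * (∫ x, V x * Φ' x) + d * (∫ x, U x * Φ x)
  set L : ℝ := ∫ x, |U x| ^ p * U x * Φ x
  set R : ℝ := ∫ x, (a * Φ'' x ^ 2 + b * Φ' x ^ 2 + d * Φ x ^ 2)
  set N : ℝ → ℝ := fun t => ∫ x, |U x + t * Φ x| ^ (p + 2) with hN
  have hN0 : N 0 = 1 := by simp [hN, h1]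
  have hNd : HasDerivAt N ((p + 2) * L) 0 := h.hasDerivAt_integral_abs_rpow hΦ hp
  have hd1 : HasDerivAt (fun t : ℝ => m + 2 * t * B + t ^ 2 * R) (2 * B) 0 := by
    have e1 := ((((hasDerivAt_id (0 : ℝ)).const_mul 2).mul_const B).const_add m).add
      ((hasDerivAt_pow 2 (0 : ℝ)).mul_const R)
    simpa using! e1
  have hd2 := (hNd.rpow_const (p := 2 / (p + 2)) (Or.inl (by rw [hN0]; exact one_ne_zero))).const_mul m
  have hd := hd1.sub hd2
  -- The function is nonnegative and vanishes at `t = 0`; homogeneity has removed the constraint, so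
  -- the multiplier is `m` itself.
  have hmin : IsLocalMin (fun t : ℝ => m + 2 * t * B + t ^ 2 * R - m * N t ^ (2 / (p + 2))) 0 := by
    refine Eventually.of_forall fun t => ?_
    have e1 := hm _ _ _ (h.add (hΦ.const_mul t))
    rw [energy_add_mul_eq h hΦ t, hE] at e1
    simp only [hN0, Real.one_rpow]
    linarith
  have h0 := hmin.hasDerivAt_eq_zero hd
  rw [hN0, Real.one_rpow] at h0
  have hq : p + 2 ≠ 0 := by linarith
  field_simp at h0
  linarith

theorem contDiff_of_hasDerivAt {f₀ f₁ f₂ f₃ f₄ : ℝ → ℝ} (h₀ : ∀ x, HasDerivAt f₀ (f₁ x) x)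
    (h₁ : ∀ x, HasDerivAt f₁ (f₂ x) x) (h₂ : ∀ x, HasDerivAt f₂ (f₃ x) x)
    (h₃ : ∀ x, HasDerivAt f₃ (f₄ x) x) (h₄ : Continuous f₄) :
    ContDiff ℝ 4 f₀ ∧ iteratedDeriv 2 f₀ = f₂ ∧ iteratedDeriv 4 f₀ = f₄ := by
  have d₀ : deriv f₀ = f₁ := funext fun x => (h₀ x).deriv
  have d₁ : deriv f₁ = f₂ := funext fun x => (h₁ x).deriv
  have d₂ : deriv f₂ = f₃ := funext fun x => (h₂ x).deriv
  have d₃ : deriv f₃ = f₄ := funext fun x => (h₃ x).deriv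
  have step : ∀ {f g : ℝ → ℝ} (n : ℕ), (∀ x, HasDerivAt f (g x) x) → ContDiff ℝ n g →
      ContDiff ℝ (n + 1 : ℕ) f := by
    intro f g n hf hg
    push_cast
    rw [contDiff_succ_iff_deriv]
    refine ⟨fun x => (hf x).differentiableAt, by simp, ?_⟩
    rwa [show deriv f = g from funext fun x => (hf x).deriv]
  refine ⟨?_, ?_, ?_⟩
  · have := step 3 h₀ (step 2 h₁ (step 1 h₂ (step 0 h₃ (by simpa using h₄))))
    exact_mod_cast this
  · simp [iteratedDeriv_succ', d₀, d₁]
  · simp [iteratedDeriv_succ', d₀, d₁, d₂, d₃]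

/-- Weak solutions in `H²(ℝ)` of `a U'''' - b U'' + d U = m |U|^p U` are classical. -/
theorem IsH2.exists_classical (hp : 1 < p) {a b d m : ℝ} (ha : 0 < a) {U V W : ℝ → ℝ}
    (h : IsH2 U V W)
    (hEL : ∀ φ : ℝ → ℝ, ContDiff ℝ ∞ φ → HasCompactSupport φ →
      a * (∫ x, W x * deriv (deriv φ) x) + b * (∫ x, V x * deriv φ x) + d * (∫ x, U x * φ x)
        = m * ∫ x, |U x| ^ p * U x * φ x) :
    ∃ f₂ f₃ f₄ : ℝ → ℝ, (∀ x, HasDerivAt U (V x) x) ∧ (∀ x, HasDerivAt V (f₂ x) x) ∧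
      (∀ x, HasDerivAt f₂ (f₃ x) x) ∧ (∀ x, HasDerivAt f₃ (f₄ x) x) ∧ Continuous f₄ ∧
      ∀ x, a * f₄ x - b * f₂ x + d * U x = m * (|U x| ^ p * U x) := by
  have hUc := h.continuous
  have hVc := h.5.continuous
  have hFc : Continuous fun x => |U x| ^ p * U x :=
    (hUc.abs.rpow_const fun x => Or.inr (by linarith)).mul hUc
  have hGc : Continuous fun x => m * (|U x| ^ p * U x) - d * U x :=
    (continuous_const.mul hFc).sub (continuous_const.mul hUc)
  -- With `P' = m|U|^p U - dU` the weak equation reads `(aW)'' = (bV + P)'`. Hence `aW` has the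
  -- continuous weak derivative `bV + P + C`, and `W` has a `C¹` representative.
  obtain ⟨P, hP⟩ := exists_isPrimitive hGc.locallyIntegrable
  have hgl : LocallyIntegrable (fun x => b * V x + P x) :=
    ((continuous_const.mul hVc).add hP.continuous).locallyIntegrable
  obtain ⟨C, hC⟩ := exists_hasWeakDeriv_add_const (f := fun x => a * W x)
    (g := fun x => b * V x + P x) (h.5.1.smul a) hgl (fun φ hφ hc => by
      have hφ1 : Continuous (deriv φ) := hφ.continuous_deriv (by simp)
      have i1 := integrable_mul_of_hasCompactSupport hVc.locallyIntegrable hφ1 hc.deriv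
      have i2 := integrable_mul_of_hasCompactSupport hP.continuous.locallyIntegrable hφ1 hc.deriv
      have i3 := integrable_mul_of_hasCompactSupport hUc.locallyIntegrable hφ.continuous hc
      have i4 := integrable_mul_of_hasCompactSupport hFc.locallyIntegrable hφ.continuous hc
      have e1 := hP.hasWeakDeriv.2.2 φ hφ hc
      have e2 : ∫ x, (m * (|U x| ^ p * U x) - d * U x) * φ x
          = m * (∫ x, |U x| ^ p * U x * φ x) - d * ∫ x, U x * φ x := by
        rw [← integral_const_mul, ← integral_const_mul, ← integral_sub (i4.const_mul m)
          (i3.const_mul d)]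
        congr 1; ext x; ring
      have e3 : ∫ x, (b * V x + P x) * deriv φ x
          = b * (∫ x, V x * deriv φ x) + ∫ x, P x * deriv φ x := by
        rw [← integral_const_mul, ← integral_add (i1.const_mul b) i2]
        congr 1; ext x; ring
      have e4 := hEL φ hφ hc
      simp only [mul_assoc a, integral_const_mul]
      rw [e3, e1, e2]
      linarith)
  obtain ⟨Z, hZ, hZP⟩ := hC.exists_isPrimitive
  have hW : W =ᵐ[volume] fun x => a⁻¹ * Z x := by
    filter_upwards [hZ] with x hx
    rw [hx, inv_mul_cancel_left₀ ha.ne']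
  have hVd := (h.5.congr_right hW).hasDerivAt (continuous_const.mul hZP.continuous)
  have hPd := hP.hasDerivAt hGc
  have hZd := hZP.hasDerivAt (((continuous_const.mul hVc).add hP.continuous).add continuous_const)
  refine ⟨fun x => a⁻¹ * Z x, fun x => a⁻¹ * (b * V x + P x + C),
    fun x => a⁻¹ * (b * (a⁻¹ * Z x) + (m * (|U x| ^ p * U x) - d * U x)),
    h.4.hasDerivAt hVc, hVd, fun x => (hZd x).const_mul _,
    fun x => ((((hVd x).const_mul b).add (hPd x)).add_const C).const_mul _,
    continuous_const.mul ((continuous_const.mul (continuous_const.mul hZP.continuous)).add hGc),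
    fun x => ?_⟩
  simp only
  rw [mul_inv_cancel_left₀ ha.ne']
  ring

end EulerLagrange

end Boussinesq

/-! ### Existence of minimizers and solitary waves -/

theorem theorem6p3 (p κ α β c : ℝ) (hp : 1 < p) (hκ : 0 < κ) (hβ : 0 < β) (hc : 1 < c ^ 2)
    (hdisc : c ^ 4 * (1 - 4 * κ) + α ^ 2 + 2 * c ^ 2 * (2 * κ - α) < 0)
    (u : ℕ → ℝ → ℝ) (hu : Boussinesq.IsMinimizingSeq p κ α c u) :
    ∃ (k : ℕ → ℕ) (y : ℕ → ℝ) (v : ℝ → ℝ),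
      StrictMono k ∧
      Boussinesq.MemH2 v ∧
      Tendsto (fun n => Boussinesq.h2Norm (fun x => u (k n) (x + y n) - v x)) atTop (𝓝 0) ∧
      Boussinesq.IsMinimizer p κ α c v ∧
      ∃ (μ : ℝ) (Q : ℝ → ℝ), 0 < μ ∧ Q =ᵐ[volume] (fun x => μ * v x) ∧
        Boussinesq.IsSolitaryWave p κ α β c Q := by
  obtain ⟨hadm, m, hglb, hlim⟩ := hu
  have ha : 0 < κ * c ^ 2 := by positivity
  -- For these coefficients `b² - 4ad` expands to the left side of `hdisc`.
  obtain ⟨δ, hδ, hco⟩ := Boussinesq.exists_coercive (a := κ * c ^ 2) (b := c ^ 2 - α)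
    (d := c ^ 2 - 1) ha (by linarith) (by linarith)
  -- The factor `½` in `functionalI` makes `2 * m` the infimum of the energy.
  have hm : ∀ U V W : ℝ → ℝ, Boussinesq.IsH2 U V W → ∫ x, |U x| ^ (p + 2) = 1 →
      2 * m ≤ ∫ x, (κ * c ^ 2 * W x ^ 2 + (c ^ 2 - α) * V x ^ 2 + (c ^ 2 - 1) * U x ^ 2) := by
    intro U V W h h1
    have h2 := hglb.1 ⟨U, (h.mem_admissible_iff EventuallyEq.rfl hp).2 h1, rfl⟩
    rw [h.functionalI_eq EventuallyEq.rfl] at h2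
    linarith
  choose U V W hUu hH using fun n => (hadm n).1.exists_isH2
  obtain ⟨k, y, v, v', v'', hk, hm0, hv, hv1, hvE, hconv⟩ :=
    Boussinesq.exists_convergent_subseq hp hδ hco hm hH
      (fun n => ((hH n).mem_admissible_iff (hUu n) hp).1 (hadm n))
      ((hlim.const_mul 2).congr fun n => by rw [(hH n).functionalI_eq (hUu n)]; ring)
  have hpos : ∀ U V W : ℝ → ℝ, Boussinesq.IsH2 U V W →
      0 ≤ ∫ x, (κ * c ^ 2 * W x ^ 2 + (c ^ 2 - α) * V x ^ 2 + (c ^ 2 - 1) * U x ^ 2) :=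
    fun U V W h => (mul_nonneg hδ.le (integral_nonneg fun x => by positivity)).trans (hco U V W h)
  refine ⟨k, y, v, hk, hv.memH2 EventuallyEq.rfl, ?_,
    ⟨(hv.mem_admissible_iff EventuallyEq.rfl hp).2 hv1, fun w hw => ?_⟩, ?_⟩
  · have h1 := hconv.sqrt
    rw [Real.sqrt_zero] at h1
    refine h1.congr fun n => ?_
    rw [(((hH (k n)).comp_add_right (y n)).sub hv).h2Norm_eq]
    have h2 := (measurePreserving_add_right (volume : Measure ℝ) (y n)).quasiMeasurePreserving.ae
      (hUu (k n))
    filter_upwards [h2] with x hx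
    rw [hx]
  · rw [hv.functionalI_eq EventuallyEq.rfl, hvE]
    have := hglb.1 ⟨w, hw, rfl⟩
    linarith
  · obtain ⟨f₂, f₃, f₄, h₀, h₁, h₂, h₃, h₄, heq⟩ := hv.exists_classical hp ha fun φ hφ hφc =>
      hv.euler_lagrange hp (fun _ _ _ h => h.mul_rpow_le_energy hp hpos hm) hv1 hvE
        (Boussinesq.isH2_of_testFunction hφ hφc)
    have hp0 : p ≠ 0 := by linarith
    have hmβ : 0 < 2 * m / β := by positivity
    -- Scaling by `μ` multiplies the linear terms by `μ` and the power by `μ^{p+1}`, so `βμ^p = 2m`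
    -- is required.
    set μ : ℝ := (2 * m / β) ^ p⁻¹ with hμ
    have hμ0 : 0 < μ := Real.rpow_pos_of_pos hmβ _
    have hμp : μ ^ p = 2 * m / β := Real.rpow_inv_rpow hmβ.le hp0
    obtain ⟨hQ, hQ2, hQ4⟩ := Boussinesq.contDiff_of_hasDerivAt (fun x => (h₀ x).const_mul μ)
      (fun x => (h₁ x).const_mul μ) (fun x => (h₂ x).const_mul μ) (fun x => (h₃ x).const_mul μ)
      (continuous_const.mul h₄)
    refine ⟨μ, fun x => μ * v x, hμ0, EventuallyEq.rfl, hQ, fun h0 => ?_, ?_, fun x => ?_⟩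
    · have hv0 : ∀ x, v x = 0 := fun x => by
        have := congrFun h0 x
        simpa [hμ0.ne'] using this
      have : (0 : ℝ) ^ (p + 2) = 0 := Real.zero_rpow (by linarith)
      simp [hv0, this] at hv1
    · simpa using (hv.4.tendsto_cocompact hv.1 hv.2).const_mul μ
    · rw [hQ2, hQ4, abs_mul, abs_of_pos hμ0, Real.mul_rpow hμ0.le (abs_nonneg _), hμp]
      have e : β * (2 * m / β * |v x| ^ p * (μ * v x)) = μ * (2 * m * (|v x| ^ p * v x)) := by
        field_simp
      rw [e, ← heq x]
      ring
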